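/- **Conventions.** Let $I=[0,1]$. Coordinates of points of $I^d$ and digits of $d$-digit base-$k$ numbers are numbered $0,\dots,d-1$, digit $0$ being the most significant. A *$d$-dimensional space-filling curve* is a continuous surjection $f:I\to I^d$. A *valid ordering* of $f$ is a function $g:I^d\to I$ with $f(g(p))=p$ for all $p\in I^d$. *Interdimensional consistency.* For a strictly increasing $\mu:\{0,\dots,d'-1\}\to\{0,\dots,d-1\}$ and $p\in I^{d'}$ let $\mu^*(p)\in I^d$ have coordinate $p_i$ at position $\mu(i)$ and zeros at all other positions. A $d$-dimensional curve $f$ is *extradimensional* to a $d'$-dimensional curve $f'$ ($d'<d$) if for every valid ordering $g'$ of $f'$ and every $\mu$ there is a valid ordering $g$ of $f$ such that $g'(a)<g'(b)\iff g(\mu^*(a))<g(\mu^*(b))$ for all $a,b\in I^{d'}$. A set consisting of one $d$-dimensional space-filling curve $f_d$ for each $d\ge1$ is *interdimensionally consistent* if $f_d$ is extradimensional to $f_{d'}$ whenever $d>d'\geq 1$. *Showing.* For a face $F=\{q\in I^{d}: q_i=e\}$, $e\in\{0,1\}$, a $d$-dimensional curve $f$ *shows* a $(d-1)$-dimensional curve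 $f'$ on $F$ if for every valid ordering $h$ of $f'$ there is a valid ordering $g$ of $f$ such that, writing $\hat a$ for $a$ with coordinate $i$ removed, $h(\hat a)<h(\hat b)\iff g(a)<g(b)$ for all $a,b\in F$, and such that $\{p: h(p)\in[s,t]\}$ is Lebesgue measurable with measure $t-s$ for all $0\le s\le t\le 1$. *Regular curves.* A *$k$-regular rule system* in dimension $d$ is a collection of rules, one of which is applied to the unit cube $I^d$. Each rule subdivides $I^d$ into the $k^d$ grid cubes of width $1/k$ and orders them by a rank $r\in\{0,\dots,k^d-1\}$. For each rank $r$ it specifies a location $c(r)\in\{0,\dots,k-1\}^d$ (the corner of the subcube $S(r)$ closest to the origin is $c(r)/k$), a rule to be applied within $S(r)$, a permutation $a(r)$ of the axes, reflections $m(r)\in\{0,1\}^d$, and whether the order within $S(r)$ is reversed. The pattern of the rule applied within $S(r)$ is placed in $S(r)$ by the map $\tau(r)$ with $\tau(r)(p)_i=\frac1k\left(c_i(r)+p_{a_i(r)}\right)$ if $m_i(r)=0$ and $\tau(r)(p)_i=\frac1k\left(c_i(r)+1-p_{a_i(r)}\right)$ if $m_i(r)=1$. Expanding the rules recursively to depth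 $\ell$ gives an ordering of $k^{d\ell}$ cells $C_0,C_1,\dots$; the curve described by the system is the function $f$ that, at every depth $\ell$, maps $[n k^{-d\ell},(n+1)k^{-d\ell}]$ onto $C_n$ for all $n$. The system (and its curve) is a *mono-curve* if there is only one rule; a mono-curve is *order-preserving* if no reversals are used. It is *vertex-continuous* if, whenever the cells of some depth are all refined to some further depth $\delta\ge1$, the last subcell within each cell shares a point with the first subcell within the next cell. *Neutral orientation.* For a mono-curve and a sequence $R=(r_1,\dots,r_\ell)$ of ranks let $a(R)=a(r_\ell)\circ\dots\circ a(r_1)$. The mono-curve has *neutral orientation* if for every permutation $\pi$ of the $d$ axes the fraction of sequences $R$ of length $\ell$ with $a(R)=\pi$ tends to $1/d!$ as $\ell\to\infty$. *The four families.* The base-$3$ reflected Gray code with one digit is the sequence $0,1,2$; the one with $d+1$ digits is the concatenation, for $\alpha=0,1,2$, of the code with $d$ digits, reversed if $\alpha$ is odd, with $\alpha$ prefixed to each element. For each $d\ge1$ consider the $3$-regular order-preserving system with a single rule, in which $c(r)$ is element $r$ (counting from $0$) of the $d$-digit code, and $m_i(r)=(\mathrm{digitsum}(r)-r_i)\bmod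 2$, where $r_0\dots r_{d-1}$ are the ternary digits of $r$ and $\mathrm{digitsum}(r)$ is their sum. The permutations $a(r)$ are as follows: * generalized *Peano* curves: $a_i(r)=i$; * generalized *coil* curves: $a_i(r)=d-1-i$; * generalized *half-coil* curves: $a_i(r)=i$ if $r$ is odd and $a_i(r)=d-1-i$ if $r$ is even; * generalized *Meurthe* curves: $a_i(r)$ is the number of zeros and ones among $r_{i+1},\dots,r_{d-1}$ if $r_i\in\{0,1\}$, and $d-1$ minus the number of twos among $r_{i+1},\dots,r_{d-1}$ if $r_i=2$. **Theorem.** For each of these four families the systems describe functions $f_d:I\to I^d$ ($d\ge1$), and these form an interdimensionally consistent set of order-preserving, $3$-regular, vertex-continuous mono-curves (in particular each $f_d$ is a space-filling curve). Moreover, for $d\ge 2$ the $d$-dimensional curve shows the $(d-1)$-dimensional curve of the same family on each of the $2d$ faces of the hypercube. In addition, for every $d\ge1$ the $d$-dimensional Meurthe curve has neutral orientation. -/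

import Mathlib

open Set Filter Topology MeasureTheory

namespace SpaceFilling

/-! ### Space-filling curves, valid orderings, extradimensionality -/

/-- The unit hypercube `[0,1]^d`; coordinates are numbered from `0` to `d - 1`. -/
abbrev Cube (d : ℕ) : Type := Fin d → unitInterval

/-- A curve filling the unit hypercube: a continuous surjection `[0,1] → [0,1]^d`. -/
def IsSpaceFillingCurve {d : ℕ} (f : unitInterval → Cube d) : Prop :=
  Continuous f ∧ Function.Surjective f

/-- A valid ordering of `f`: a choice, for every point `p` of the hypercube, of a parameter at
which `f` visits `p`. (Such a choice is automatically injective.) -/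
def IsValidOrdering {d : ℕ} (f : unitInterval → Cube d) (g : Cube d → unitInterval) : Prop :=
  ∀ p, f (g p) = p

/-- Put coordinate `i` of `p` at position `μ i`, and zeros at the positions that `μ` does not
select. -/
noncomputable def lift {d' d : ℕ} (μ : Fin d' → Fin d) (p : Cube d') : Cube d :=
  Function.extend μ p (fun _ => 0)

/-- `f` is extradimensional to `f'`. -/
def IsExtradimensionalTo {d d' : ℕ} (f : unitInterval → Cube d) (f' : unitInterval → Cube d') :
    Prop :=
  ∀ g' : Cube d' → unitInterval, IsValidOrdering f' g' →
    ∀ μ : Fin d' → Fin d, StrictMono μ →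
      ∃ g : Cube d → unitInterval, IsValidOrdering f g ∧
        ∀ a b : Cube d', g' a < g' b ↔ g (lift μ a) < g (lift μ b)

/-- A set of curves that contains exactly one `d`-dimensional space-filling curve `f d` for every
`d ≥ 1` (the value of the family at `d = 0` is disregarded) is interdimensionally consistent. -/
def IsInterdimensionallyConsistent (f : (d : ℕ) → unitInterval → Cube d) : Prop :=
  (∀ d, 1 ≤ d → IsSpaceFillingCurve (f d)) ∧
    ∀ d' d, 1 ≤ d' → d' < d → IsExtradimensionalTo (f d) (f d')

/-! ### Visible orders on faces -/

/-- The face of the hypercube on which coordinate `i` equals `e`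
(`e = 0`: front face, `e = 1`: back face). -/
def face {d : ℕ} (i : Fin (d + 1)) (e : unitInterval) : Set (Cube (d + 1)) :=
  {q | q i = e}

/-- `h` is the visible order of `g` on the face where coordinate `i` equals `e`: it orders the
points of the face, with coordinate `i` taken out, as `g` does, and is parametrized by volume. -/
def IsVisibleOrder {d : ℕ} (g : Cube (d + 1) → unitInterval) (i : Fin (d + 1)) (e : unitInterval)
    (h : Cube d → unitInterval) : Prop :=
  (∀ a ∈ face i e, ∀ b ∈ face i e, h (i.removeNth a) < h (i.removeNth b) ↔ g a < g b) ∧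
    ∀ s t : unitInterval, s ≤ t →
      NullMeasurableSet {p | h p ∈ Icc s t} (volume : Measure (Cube d)) ∧
        volume {p | h p ∈ Icc s t} = ENNReal.ofReal ((t : ℝ) - (s : ℝ))

/-- The `(d+1)`-dimensional curve `f` shows the `d`-dimensional curve `f'` on the face where
coordinate `i` equals `e`. -/
def ShowsOnFace {d : ℕ} (f : unitInterval → Cube (d + 1)) (f' : unitInterval → Cube d)
    (i : Fin (d + 1)) (e : unitInterval) : Prop :=
  ∀ h : Cube d → unitInterval, IsValidOrdering f' h →
    ∃ g : Cube (d + 1) → unitInterval, IsValidOrdering f g ∧ IsVisibleOrder g i e h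

/-! ### Regular rule systems and the curves that they define -/

/-- The similarity of factor `1/k` that rotates axis `a i` onto axis `i`, reflects the axes `i`
with `m i = true`, and moves the unit cube onto the cell of the `k × ⋯ × k` grid whose corner
closest to the origin is `c / k`. -/
noncomputable def place {k d : ℕ} (c : Fin d → Fin k) (a : Fin d → Fin d) (m : Fin d → Bool)
    (p : Cube d) : Cube d :=
  fun i => ⟨(((c i : ℕ) : ℝ) + (if m i then 1 - (p (a i) : ℝ) else (p (a i) : ℝ))) / (k : ℝ), by
    have h0 := (p (a i)).2.1
    have h1 := (p (a i)).2.2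
    have hc : (((c i : ℕ) : ℝ)) + 1 ≤ k := by exact_mod_cast (c i).2
    have hc0 : (0 : ℝ) ≤ ((c i : ℕ) : ℝ) := Nat.cast_nonneg _
    have hk : (0 : ℝ) < k := by linarith
    constructor
    · apply div_nonneg _ hk.le
      split_ifs <;> linarith
    · rw [div_le_one hk]
      split_ifs <;> linarith⟩

/-- A `k`-regular rule system in dimension `d`. Every rule subdivides the unit hypercube into the
`k ^ d` grid cells of width `1 / k` and visits them in the order of their rank `r`. -/
structure RegularRuleSystem (k d : ℕ) where
  /-- the rules -/
  Rule : Type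
  /-- the rule that is applied to the unit hypercube -/
  start : Rule
  /-- the location `c(r)` of the subregion of rank `r` -/
  location : Rule → Fin (k ^ d) → Fin d → Fin k
  /-- each grid cell occurs exactly once -/
  location_bijective : ∀ ρ, Function.Bijective (location ρ)
  /-- the rule that is applied within the subregion of rank `r` -/
  child : Rule → Fin (k ^ d) → Rule
  /-- the rotation `a(r)`: axis `a_i(r)` is rotated onto axis `i` -/
  rotation : Rule → Fin (k ^ d) → Equiv.Perm (Fin d)
  /-- the reflections `m(r)` -/
  reflection : Rule → Fin (k ^ d) → Fin d → Bool
  /-- whether the order within the subregion of rank `r` is reversed -/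
  reversed : Rule → Fin (k ^ d) → Bool

namespace RegularRuleSystem

variable {k d : ℕ}

/-- The cell that is visited as number `n` (counting from zero) in the scanning order that results
from expanding rule `ρ` to depth `l`. -/
noncomputable def cell (S : RegularRuleSystem k d) :
    (l : ℕ) → S.Rule → Fin ((k ^ d) ^ l) → Set (Cube d)
  | 0, _, _ => univ
  | l + 1, ρ, n =>
    let q := finProdFinEquiv.symm (Fin.cast (pow_succ' (k ^ d) l) n)
    place (S.location ρ q.1) (S.rotation ρ q.1) (S.reflection ρ q.1) ''
      S.cell l (S.child ρ q.1) (if S.reversed ρ q.1 then q.2.rev else q.2)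

/-- The parameter interval that belongs to cell number `n` at depth `l`. -/
def interval (k d l : ℕ) (n : Fin ((k ^ d) ^ l)) : Set unitInterval :=
  {t | ((n : ℕ) : ℝ) / ((k : ℝ) ^ d) ^ l ≤ (t : ℝ) ∧
    (t : ℝ) ≤ (((n : ℕ) : ℝ) + 1) / ((k : ℝ) ^ d) ^ l}

/-- `f` is the curve defined by the scanning order: at every depth, it maps the `n`-th interval
to the `n`-th cell. -/
def Describes (S : RegularRuleSystem k d) (f : unitInterval → Cube d) : Prop :=
  ∀ (l : ℕ) (n : Fin ((k ^ d) ^ l)), f '' interval k d l n = S.cell l S.start n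

/-- The curve of a rule system: the point at parameter `t` is the common point of all cells whose
intervals contain `t` (an arbitrary value if there is no such point). -/
noncomputable def curve (S : RegularRuleSystem k d) (t : unitInterval) : Cube d :=
  Classical.epsilon fun p : Cube d =>
    ∀ (l : ℕ) (n : Fin ((k ^ d) ^ l)), t ∈ interval k d l n → p ∈ S.cell l S.start n

/-- There is only a single rule. -/
def IsMono (S : RegularRuleSystem k d) : Prop := Subsingleton S.Rule

/-- There is only a single rule, and it uses no reversals. -/
def IsOrderPreserving (S : RegularRuleSystem k d) : Prop :=
  S.IsMono ∧ ∀ ρ r, S.reversed ρ r = false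

/-- Whenever the cells of depth `l` are refined to depth `e ≥ 1`, the last cell `u` within cell
number `n` shares a point with the first cell `v` within cell number `n + 1`. (Each cell of
depth `l` is refined into `(k ^ d) ^ e` consecutive cells of depth `l + e`.) -/
def IsVertexContinuous (S : RegularRuleSystem k d) : Prop :=
  ∀ l e : ℕ, 1 ≤ e → ∀ n : ℕ, n + 1 < (k ^ d) ^ l → ∀ u v : Fin ((k ^ d) ^ (l + e)),
    (u : ℕ) + 1 = (n + 1) * (k ^ d) ^ e → (v : ℕ) = (n + 1) * (k ^ d) ^ e →
      (S.cell (l + e) S.start u ∩ S.cell (l + e) S.start v).Nonempty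

/-- The rotation component `a(R)` of the curve within the region `S(R)`, for a mono-curve: the
identity if `R` is empty, and otherwise `a(last R)` applied to `a(prefix R)`. -/
def orientation (S : RegularRuleSystem k d) :
    (l : ℕ) → (Fin l → Fin (k ^ d)) → Equiv.Perm (Fin d)
  | 0, _ => 1
  | l + 1, R => S.rotation S.start (R (Fin.last l)) * S.orientation l (Fin.init R)

/-- Neutral orientation of a mono-curve: as the depth grows, the frequency of each permutation
among the orientations of the regions of that depth tends to `1 / d!`. -/
def HasNeutralOrientation (S : RegularRuleSystem k d) : Prop :=
  S.IsMono ∧ ∀ π : Equiv.Perm (Fin d),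
    Tendsto (fun l : ℕ =>
        (Nat.card {R : Fin l → Fin (k ^ d) // S.orientation l R = π} : ℝ) / ((k : ℝ) ^ d) ^ l)
      atTop (𝓝 (1 / (Nat.factorial d : ℝ)))

end RegularRuleSystem

/-! ### Reflected Gray codes and the four families -/

/-- Digit `i` of the `d`-digit base-`k` number `r`; digit `0` is the most significant one. -/
def digit (k : ℕ) {d : ℕ} (r : Fin (k ^ d)) (i : Fin d) : ℕ :=
  (r : ℕ) / k ^ (d - 1 - (i : ℕ)) % k

/-- Element `r` of the base-`k` reflected Gray code with `d` digits. The code with `d + 1` digits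
is the concatenation, for `a = 0, …, k - 1`, of the code with `d` digits, reversed if `a` is odd,
with `a` prefixed to all its elements. -/
def grayCode (k : ℕ) : (d : ℕ) → Fin (k ^ d) → Fin d → Fin k
  | 0, _ => Fin.elim0
  | d + 1, r =>
    let q := finProdFinEquiv.symm (Fin.cast (pow_succ' k d) r)
    Fin.cons q.1 (grayCode k d (if Odd (q.1 : ℕ) then q.2.rev else q.2))

theorem grayCode_bijective (k d : ℕ) : Function.Bijective (grayCode k d) := by
  rw [Fintype.bijective_iff_injective_and_card]
  refine ⟨?_, by simp⟩
  induction d with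
  | zero =>
    intro r s _
    have hr := r.2
    have hs := s.2
    simp only [pow_zero] at hr hs
    exact Fin.ext (by omega)
  | succ d ih =>
    intro r s h
    simp only [grayCode] at h
    rw [Fin.cons_inj] at h
    obtain ⟨h1, h2⟩ := h
    have h3 := ih h2
    rw [h1] at h3
    have h4 : (finProdFinEquiv.symm (Fin.cast (pow_succ' k d) r)).2 =
        (finProdFinEquiv.symm (Fin.cast (pow_succ' k d) s)).2 := by
      split_ifs at h3
      · exact Fin.rev_injective h3
      · exact h3
    have h5 := finProdFinEquiv.symm.injective (Prod.ext h1 h4)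
    exact Fin.ext (by simpa using congrArg Fin.val h5)

/-- The mono-rule without reversals that visits the subregions in the order of the ternary
reflected Gray code, with reflections `m_i(r) = (digitsum(r) - r_i) mod 2` and rotations `a`. -/
def wunderlich (d : ℕ) (a : Fin (3 ^ d) → Equiv.Perm (Fin d)) : RegularRuleSystem 3 d where
  Rule := Unit
  start := ()
  location := fun _ => grayCode 3 d
  location_bijective := fun _ => grayCode_bijective 3 d
  child := fun _ _ => ()
  rotation := fun _ => a
  reflection := fun _ r i => decide (((∑ j, digit 3 r j) - digit 3 r i) % 2 = 1)
  reversed := fun _ _ => false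

/-- Generalized Peano curves: all rotations are the identity. -/
def peano (d : ℕ) : RegularRuleSystem 3 d := wunderlich d fun _ => 1

/-- Generalized coil curves: all rotations are the reversal `i ↦ d - 1 - i`. -/
def coil (d : ℕ) : RegularRuleSystem 3 d := wunderlich d fun _ => Fin.revPerm

/-- Generalized half-coil curves: identity if the rank is odd, reversal if it is even. -/
def halfCoil (d : ℕ) : RegularRuleSystem 3 d :=
  wunderlich d fun r => if Odd (r : ℕ) then 1 else Fin.revPerm

/-- The number `a_i(r)` of the Meurthe curves: if `r_i` is `2`, it is `d - 1` minus the number of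
twos among `r_{i+1}, …, r_{d-1}`; if `r_i` is `0` or `1`, it is the number of zeros and ones among
`r_{i+1}, …, r_{d-1}`. -/
def meurtheIndex {d : ℕ} (r : Fin (3 ^ d)) (i : Fin d) : ℕ :=
  if digit 3 r i = 2 then d - 1 - (Finset.univ.filter fun j => i < j ∧ digit 3 r j = 2).card
  else (Finset.univ.filter fun j => i < j ∧ (digit 3 r j = 0 ∨ digit 3 r j = 1)).card

theorem meurthe_aux {d : ℕ} (r : Fin (3 ^ d)) (i : Fin d) :
    (Finset.univ.filter fun j => i < j ∧ digit 3 r j = 2).card +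
      (Finset.univ.filter fun j => i < j ∧ (digit 3 r j = 0 ∨ digit 3 r j = 1)).card =
        d - 1 - i := by
  rw [← Finset.card_union_of_disjoint]
  · rw [← Fin.card_Ioi]
    congr 1
    ext j
    have hj : digit 3 r j < 3 := Nat.mod_lt _ (by norm_num)
    simp only [Finset.mem_union, Finset.mem_filter, Finset.mem_univ, true_and, Finset.mem_Ioi]
    constructor
    · rintro (h | h)
      exacts [h.1, h.1]
    · intro h
      have h3 : digit 3 r j = 2 ∨ digit 3 r j = 0 ∨ digit 3 r j = 1 := by omega
      exact h3.imp (fun h' => ⟨h, h'⟩) (fun h' => ⟨h, h'⟩)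
  · rw [Finset.disjoint_left]
    intro j hj hj'
    simp only [Finset.mem_filter, Finset.mem_univ, true_and] at hj hj'
    omega

theorem meurtheIndex_lt {d : ℕ} (r : Fin (3 ^ d)) (i : Fin d) : meurtheIndex r i < d := by
  have h := meurthe_aux r i
  have hi := i.2
  unfold meurtheIndex
  split_ifs <;> omega

theorem meurtheIndex_ne {d : ℕ} (r : Fin (3 ^ d)) {i j : Fin d} (hij : i < j) :
    meurtheIndex r i ≠ meurtheIndex r j := by
  have hi := meurthe_aux r i
  have hj := meurthe_aux r j
  have hij' : (i : ℕ) < j := hij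
  have hjd := j.2
  have hdi : digit 3 r j < 3 := Nat.mod_lt _ (by norm_num)
  have mono2 : (Finset.univ.filter fun l => j < l ∧ digit 3 r l = 2).card ≤
      (Finset.univ.filter fun l => i < l ∧ digit 3 r l = 2).card :=
    Finset.card_le_card fun l hl => by
      simp only [Finset.mem_filter, Finset.mem_univ, true_and] at hl ⊢
      exact ⟨hij.trans hl.1, hl.2⟩
  have mono01 : (Finset.univ.filter fun l => j < l ∧ (digit 3 r l = 0 ∨ digit 3 r l = 1)).card ≤
      (Finset.univ.filter fun l => i < l ∧ (digit 3 r l = 0 ∨ digit 3 r l = 1)).card :=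
    Finset.card_le_card fun l hl => by
      simp only [Finset.mem_filter, Finset.mem_univ, true_and] at hl ⊢
      exact ⟨hij.trans hl.1, hl.2⟩
  have lt2 : digit 3 r j = 2 → (Finset.univ.filter fun l => j < l ∧ digit 3 r l = 2).card <
      (Finset.univ.filter fun l => i < l ∧ digit 3 r l = 2).card := fun h =>
    Finset.card_lt_card <| by
      rw [Finset.ssubset_iff_of_subset]
      · exact ⟨j, by simp [h, hij], by simp⟩
      · intro l hl
        simp only [Finset.mem_filter, Finset.mem_univ, true_and] at hl ⊢
        exact ⟨hij.trans hl.1, hl.2⟩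
  have lt01 : digit 3 r j ≠ 2 →
      (Finset.univ.filter fun l => j < l ∧ (digit 3 r l = 0 ∨ digit 3 r l = 1)).card <
      (Finset.univ.filter fun l => i < l ∧ (digit 3 r l = 0 ∨ digit 3 r l = 1)).card := fun h =>
    Finset.card_lt_card <| by
      rw [Finset.ssubset_iff_of_subset]
      · exact ⟨j, by
          simp only [Finset.mem_filter, Finset.mem_univ, true_and]
          exact ⟨hij, by omega⟩, by simp⟩
      · intro l hl
        simp only [Finset.mem_filter, Finset.mem_univ, true_and] at hl ⊢
        exact ⟨hij.trans hl.1, hl.2⟩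
  unfold meurtheIndex
  split_ifs with h1 h2 h2
  · have := lt2 h2
    omega
  · have := lt01 h2
    omega
  · have := lt2 h2
    omega
  · have := lt01 h2
    omega

theorem meurtheIndex_bijective {d : ℕ} (r : Fin (3 ^ d)) :
    Function.Bijective fun i : Fin d => (⟨meurtheIndex r i, meurtheIndex_lt r i⟩ : Fin d) := by
  rw [← Finite.injective_iff_bijective]
  intro i j h
  have h' : meurtheIndex r i = meurtheIndex r j := congrArg Fin.val h
  rcases lt_trichotomy i j with hij | hij | hij
  · exact absurd h' (meurtheIndex_ne r hij)
  · exact hij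
  · exact absurd h'.symm (meurtheIndex_ne r hij)

/-- Generalized Meurthe curves. -/
noncomputable def meurthe (d : ℕ) : RegularRuleSystem 3 d :=
  wunderlich d fun r => Equiv.ofBijective _ (meurtheIndex_bijective r)

end SpaceFilling

open SpaceFilling

/-!
All four families use the same grid of subcubes, the same Gray code and the same reflections; they
differ only in the rotations. The proof treats an arbitrary choice of rotations as far as possible.

*The curve.* A sequence `s` of ranks codes the parameter `Real.ofDigits s` and the point
`codedPoint a s` in which its nested cells meet. Within a cell the pattern runs from the image of
the corner `(0, …, 0)` to the image of the corner `(1, …, 1)`, and a rotation moves neither corner,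
so whether the curve is continuous depends on the Gray code and the reflections alone: each cell is
left at the corner where the next one is entered (`exitCorner_eq_entryCorner`). Hence consecutive
cells of any depth meet, two codes of one parameter code the same point, and
`Real.ofDigits s ↦ codedPoint a s` is a well-defined continuous surjection that the system
describes.

*Faces.* The cells that touch the face where coordinate `i` is `0` or `1` have the ranks that
arise from the ranks of the curve of one dimension less by inserting an even digit at position `i`.
This insertion (`insertRank`) preserves the order, and, the digit being even, the Gray code and the
reflections in the other axes. Each such cell touches the face of the cube with a face of its own
pattern; the corresponding statement about the rotations, `IsFaceCompatible`, is checked for each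
family. Applying the insertion at every depth turns codes on the face into codes in the cube
(`codedPoint_faceCode`) in a monotone way, so the curve traces the lower-dimensional curve on every
face (`traces_faceEmb`). Valid orderings extend along such a trace, which gives the visible orders
on the faces and, by composing embeddings of front faces, interdimensional consistency.

*Volume.* The image of `[s, t]` has volume at most `t - s`, and for any valid ordering `h` the set
`h⁻¹ [s, t]` lies between the complement of the image of `[0, s] ∪ [t, 1]` and the image of
`[s, t]`; the two have the same volume.

*Neutral orientation.* The orientations of the cells of depth `l` are distributed like a random
walk on the symmetric group with uniformly chosen steps `a(r)`. Such a walk converges to the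
uniform distribution when the steps generate the group and one of them is trivial
(`tendsto_walk`). For the Meurthe curves the ranks with a single digit `0` and all other digits
`2` give all cycles `0 ↦ 1 ↦ ⋯ ↦ i ↦ 0`, among them the identity and two generators.
-/

namespace SpaceFilling

/-! ### Ranks as digit strings -/

/-- The `(d + 1)`-digit number with leading digit `x`, followed by the `d` digits of `q`. -/
def consRank {k d : ℕ} (x : Fin k) (q : Fin (k ^ d)) : Fin (k ^ (d + 1)) :=
  Fin.cast (pow_succ' k d).symm (finProdFinEquiv (x, q))

theorem consRank_val {k d : ℕ} (x : Fin k) (q : Fin (k ^ d)) :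
    (consRank x q : ℕ) = q + k ^ d * x := rfl

theorem exists_consRank {k d : ℕ} (r : Fin (k ^ (d + 1))) : ∃ x q, r = consRank (d := d) x q := by
  refine ⟨(finProdFinEquiv.symm (Fin.cast (pow_succ' k d) r)).1,
    (finProdFinEquiv.symm (Fin.cast (pow_succ' k d) r)).2, ?_⟩
  rw [consRank, Prod.mk.eta, Equiv.apply_symm_apply]
  rfl

theorem consRank_symm {k d : ℕ} (x : Fin k) (q : Fin (k ^ d)) :
    finProdFinEquiv.symm (Fin.cast (pow_succ' k d) (consRank x q)) = (x, q) :=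
  finProdFinEquiv.symm_apply_apply (x, q)

theorem consRank_lt_iff {k d : ℕ} {x y : Fin k} {q r : Fin (k ^ d)} :
    consRank x q < consRank y r ↔ x < y ∨ x = y ∧ q < r := by
  have hq := q.2
  have hr := r.2
  rw [Fin.lt_def, Fin.lt_def, Fin.lt_def, Fin.ext_iff, consRank_val, consRank_val]
  rcases lt_trichotomy (x : ℕ) y with h | h | h
  · have : k ^ d * (x + 1) ≤ k ^ d * y := Nat.mul_le_mul_left _ h
    rw [mul_add] at this
    omega
  · simp [h]
  · have : k ^ d * (y + 1) ≤ k ^ d * x := Nat.mul_le_mul_left _ h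
    rw [mul_add] at this
    omega

theorem consRank_last {k l : ℕ} {x : Fin k} {q : Fin (k ^ l)}
    (h : (consRank x q : ℕ) + 1 = k ^ (l + 1)) : (x : ℕ) + 1 = k ∧ (q : ℕ) + 1 = k ^ l := by
  have hq := q.2
  have hx : (x : ℕ) + 1 ≤ k := x.2
  rw [consRank_val, pow_succ] at h
  have h1 : k ^ l * (x + 1) ≤ k ^ l * k := Nat.mul_le_mul_left _ hx
  have h2 : k ^ l * (x + 1) = k ^ l * k := by
    rw [mul_add] at *
    omega
  have h3 := Nat.eq_of_mul_eq_mul_left (by omega) h2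
  refine ⟨h3, ?_⟩
  rw [mul_add] at h2
  omega

theorem consRank_add_one {k l : ℕ} {x y : Fin k} {q p : Fin (k ^ l)}
    (h : (consRank x q : ℕ) + 1 = consRank y p) :
    x = y ∧ (q : ℕ) + 1 = p ∨ (x : ℕ) + 1 = y ∧ (q : ℕ) + 1 = k ^ l ∧ (p : ℕ) = 0 := by
  have hq := q.2
  have hp := p.2
  rw [consRank_val, consRank_val] at h
  rcases Nat.lt_trichotomy (x : ℕ) y with hxy | hxy | hxy
  · have h1 : k ^ l * ((x : ℕ) + 1) ≤ k ^ l * y := Nat.mul_le_mul_left _ hxy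
    rw [mul_add] at h1
    refine Or.inr ⟨?_, by omega, by omega⟩
    have : k ^ l * ((x : ℕ) + 1) = k ^ l * y := by rw [mul_add]; omega
    exact Nat.eq_of_mul_eq_mul_left (by omega) this
  · rw [hxy] at h
    exact Or.inl ⟨Fin.ext hxy, by omega⟩
  · have h1 : k ^ l * ((y : ℕ) + 1) ≤ k ^ l * x := Nat.mul_le_mul_left _ hxy
    rw [mul_add] at h1
    omega

theorem consRank_rev {k d : ℕ} (x : Fin k) (q : Fin (k ^ d)) :
    (consRank x q).rev = consRank x.rev q.rev := by
  apply Fin.ext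
  have hq := q.2
  have hx : (x : ℕ) + 1 ≤ k := x.2
  have h : k ^ d * (x + 1) ≤ k ^ d * k := Nat.mul_le_mul_left _ hx
  rw [Fin.val_rev, consRank_val, consRank_val, Fin.val_rev, Fin.val_rev, Nat.mul_sub, pow_succ]
  rw [mul_add] at *
  omega

theorem digit_consRank_zero {k d : ℕ} (x : Fin k) (q : Fin (k ^ d)) :
    digit k (consRank x q) 0 = x := by
  have h0 : 0 < k ^ d := q.pos
  simp [digit, consRank_val, Nat.add_mul_div_left _ _ h0, Nat.div_eq_of_lt q.2,
    Nat.mod_eq_of_lt x.2]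

theorem digit_consRank_succ {k d : ℕ} (x : Fin k) (q : Fin (k ^ d)) (i : Fin d) :
    digit k (consRank x q) i.succ = digit k q i := by
  have hi := i.2
  have hk : 0 < k := x.pos
  have h1 : d + 1 - 1 - (i.succ : ℕ) = d - 1 - i := by simp; omega
  have h2 : k ^ d = k ^ (d - 1 - i) * (k * k ^ (i : ℕ)) := by
    rw [← pow_succ', ← pow_add]
    congr 1
    omega
  unfold digit
  have h3 : k ^ d * (x : ℕ) = k ^ (d - 1 - i) * (k * (k ^ (i : ℕ) * x)) := by
    rw [h2, mul_assoc, mul_assoc]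
  rw [h1, consRank_val, h3, Nat.add_mul_div_left _ _ (by positivity), Nat.add_mul_mod_self_left]

theorem sum_digit_consRank {k d : ℕ} (x : Fin k) (q : Fin (k ^ d)) :
    ∑ j, digit k (consRank x q) j = x + ∑ j, digit k q j := by
  simp [Fin.sum_univ_succ, digit_consRank_zero, digit_consRank_succ]

theorem digit_lt {d : ℕ} (r : Fin (3 ^ d)) (i : Fin d) : digit 3 r i < 3 :=
  Nat.mod_lt _ (by norm_num)

theorem grayCode_consRank {k d : ℕ} (x : Fin k) (q : Fin (k ^ d)) :
    grayCode k (d + 1) (consRank x q) =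
      Fin.cons x (grayCode k d (if Odd (x : ℕ) then q.rev else q)) := by
  simp only [grayCode, consRank_symm]

/-- Reversing the rank reflects the grid cell in the centre of the grid, because complementing the
ternary digits does not change their parities. -/
theorem grayCode_rev {d : ℕ} (r : Fin (3 ^ d)) (i : Fin d) :
    grayCode 3 d r.rev i = (grayCode 3 d r i).rev := by
  induction d with
  | zero => exact i.elim0
  | succ d ih =>
    obtain ⟨x, q, rfl⟩ := exists_consRank r
    have hx : Odd (x.rev : ℕ) ↔ Odd (x : ℕ) := by
      fin_cases x <;> decide
    rw [consRank_rev, grayCode_consRank, grayCode_consRank]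
    refine Fin.cases ?_ (fun j => ?_) i
    · simp
    · simp only [Fin.cons_succ, hx]
      split_ifs
      · exact ih _ _
      · exact ih _ _

theorem grayCode_consRank_succ {d : ℕ} (x : Fin 3) (q : Fin (3 ^ d)) (i : Fin d) :
    grayCode 3 (d + 1) (consRank x q) i.succ =
      if Odd (x : ℕ) then (grayCode 3 d q i).rev else grayCode 3 d q i := by
  rw [grayCode_consRank, Fin.cons_succ]
  split_ifs
  · exact grayCode_rev _ _
  · rfl

/-- A number has the parity of its ternary digit sum. -/
theorem sum_digit_mod_two {d : ℕ} (r : Fin (3 ^ d)) :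
    (∑ j, digit 3 r j) % 2 = (r : ℕ) % 2 := by
  induction d with
  | zero =>
    simp
  | succ d ih =>
    obtain ⟨x, q, rfl⟩ := exists_consRank r
    rw [sum_digit_consRank, consRank_val, Nat.add_mod, ih q, Nat.add_mod (q : ℕ), Nat.mul_mod,
      Nat.pow_mod]
    simp [add_comm]

/-! ### Reflections and the entry and exit corners of a cell -/

/-- The reflection in axis `i` that is applied within the cell of rank `r`. -/
def reflect {d : ℕ} (r : Fin (3 ^ d)) (i : Fin d) : Bool :=
  decide (((∑ j, digit 3 r j) - digit 3 r i) % 2 = 1)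

theorem digit_le_sum {d : ℕ} (r : Fin (3 ^ d)) (i : Fin d) :
    digit 3 r i ≤ ∑ j, digit 3 r j :=
  Finset.single_le_sum (f := fun j => digit 3 r j) (fun _ _ => Nat.zero_le _) (Finset.mem_univ i)

theorem reflect_consRank_zero {d : ℕ} (x : Fin 3) (q : Fin (3 ^ d)) :
    reflect (consRank x q) 0 = decide (Odd (q : ℕ)) := by
  have h := sum_digit_mod_two q
  simp only [reflect, sum_digit_consRank, digit_consRank_zero, Nat.odd_iff, decide_eq_decide]
  omega

theorem reflect_consRank_succ {d : ℕ} (x : Fin 3) (q : Fin (3 ^ d)) (i : Fin d) :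
    reflect (consRank x q) i.succ = (reflect q i ^^ decide (Odd (x : ℕ))) := by
  have h := digit_le_sum q i
  simp only [reflect, sum_digit_consRank, digit_consRank_succ, Nat.odd_iff]
  rw [Bool.eq_iff_iff]
  simp only [decide_eq_true_eq, Bool.xor_iff_ne, ne_eq, decide_eq_decide]
  omega

/-- Three times coordinate `i` of the point at which the curve enters the cell of rank `r`. -/
def entryCorner {d : ℕ} (r : Fin (3 ^ d)) (i : Fin d) : ℕ :=
  grayCode 3 d r i + if reflect r i then 1 else 0

/-- Three times coordinate `i` of the point at which the curve leaves the cell of rank `r`. -/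
def exitCorner {d : ℕ} (r : Fin (3 ^ d)) (i : Fin d) : ℕ :=
  grayCode 3 d r i + if reflect r i then 0 else 1

theorem entryCorner_consRank_zero {d : ℕ} (x : Fin 3) (q : Fin (3 ^ d)) :
    entryCorner (consRank x q) 0 = x + if Odd (q : ℕ) then 1 else 0 := by
  simp [entryCorner, reflect_consRank_zero, grayCode_consRank]

theorem exitCorner_consRank_zero {d : ℕ} (x : Fin 3) (q : Fin (3 ^ d)) :
    exitCorner (consRank x q) 0 = x + if Odd (q : ℕ) then 0 else 1 := by
  simp [exitCorner, reflect_consRank_zero, grayCode_consRank]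

theorem entryCorner_consRank_succ {d : ℕ} (x : Fin 3) (q : Fin (3 ^ d)) (i : Fin d) :
    entryCorner (consRank x q) i.succ =
      if Odd (x : ℕ) then 3 - entryCorner q i else entryCorner q i := by
  have h := (grayCode 3 d q i).2
  unfold entryCorner
  rw [reflect_consRank_succ, grayCode_consRank_succ]
  by_cases hx : Odd (x : ℕ) <;> cases reflect q i <;> (simp [hx, Fin.val_rev]; try omega)

theorem exitCorner_consRank_succ {d : ℕ} (x : Fin 3) (q : Fin (3 ^ d)) (i : Fin d) :
    exitCorner (consRank x q) i.succ =
      if Odd (x : ℕ) then 3 - exitCorner q i else exitCorner q i := by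
  have h := (grayCode 3 d q i).2
  unfold exitCorner
  rw [reflect_consRank_succ, grayCode_consRank_succ]
  by_cases hx : Odd (x : ℕ) <;> cases reflect q i <;> (simp [hx, Fin.val_rev]; try omega)

theorem entryCorner_first {d : ℕ} (r : Fin (3 ^ d)) (hr : (r : ℕ) = 0) (i : Fin d) :
    entryCorner r i = 0 := by
  induction d with
  | zero => exact i.elim0
  | succ d ih =>
    obtain ⟨x, q, rfl⟩ := exists_consRank r
    have h0 : 0 < 3 ^ d := q.pos
    rw [consRank_val, Nat.add_eq_zero_iff, mul_eq_zero] at hr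
    have hx : (x : ℕ) = 0 := by omega
    refine Fin.cases ?_ (fun j => ?_) i
    · simp [entryCorner_consRank_zero, hx, hr.1]
    · simp [entryCorner_consRank_succ, hx, ih q hr.1]

theorem not_odd_of_add_one_eq {d q : ℕ} (h : q + 1 = 3 ^ d) : ¬ Odd q := by
  have h3 : Odd (3 ^ d) := Odd.pow (by decide)
  rw [← h] at h3
  exact fun hq => (Nat.not_odd_iff_even.2 hq.add_one) h3

theorem exitCorner_last {d : ℕ} (r : Fin (3 ^ d)) (hr : (r : ℕ) + 1 = 3 ^ d) (i : Fin d) :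
    exitCorner r i = 3 := by
  induction d with
  | zero => exact i.elim0
  | succ d ih =>
    obtain ⟨x, q, rfl⟩ := exists_consRank r
    obtain ⟨hx, hq⟩ := consRank_last hr
    have hx' : (x : ℕ) = 2 := by omega
    refine Fin.cases ?_ (fun j => ?_) i
    · simp [exitCorner_consRank_zero, hx', not_odd_of_add_one_eq hq]
    · simp [exitCorner_consRank_succ, hx', ih q hq]

/-- The curve leaves each cell at the corner where it enters the next one. -/
theorem exitCorner_eq_entryCorner {d : ℕ} (r s : Fin (3 ^ d)) (h : (r : ℕ) + 1 = s) (i : Fin d) :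
    exitCorner r i = entryCorner s i := by
  induction d with
  | zero => exact i.elim0
  | succ d ih =>
    obtain ⟨x, q, rfl⟩ := exists_consRank r
    obtain ⟨y, p, rfl⟩ := exists_consRank s
    rcases consRank_add_one h with ⟨rfl, hqp⟩ | ⟨hy, hq, hp⟩
    · refine Fin.cases ?_ (fun j => ?_) i
      · simp only [exitCorner_consRank_zero, entryCorner_consRank_zero, ← hqp, Nat.odd_add_one]
        split_ifs <;> simp_all
      · rw [exitCorner_consRank_succ, entryCorner_consRank_succ, ih q p hqp]
    · refine Fin.cases ?_ (fun j => ?_) i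
      · simp [exitCorner_consRank_zero, entryCorner_consRank_zero, not_odd_of_add_one_eq hq, hp,
          ← hy]
      · rw [exitCorner_consRank_succ, entryCorner_consRank_succ, exitCorner_last q hq,
          entryCorner_first p hp, ← hy]
        by_cases hx : Odd (x : ℕ) <;> simp [hx, Nat.odd_add_one]

/-! ### Inserting a digit -/

/-- The even ternary digit `0` or `2` that selects the grid cells at the front or the back face. -/
def sideDigit (e : Bool) : Fin 3 := if e then 2 else 0

/-- The coordinate `0` or `1` of the front or back face. -/
def side (e : Bool) : unitInterval := if e then 1 else 0

/-- The rank of the grid cell that is visited as number `r` among those that touch the face where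
coordinate `i` equals `side e`: an even digit is inserted at position `i`. After an odd leading
digit the remaining Gray code is reversed, which exchanges the two sides. -/
def insertRank : (d : ℕ) → Fin (d + 1) → Bool → Fin (3 ^ d) → Fin (3 ^ (d + 1))
  | 0, _, e, r => consRank (sideDigit e) r
  | d + 1, i, e, r =>
    Fin.cases (motive := fun _ => Fin (3 ^ (d + 1 + 1))) (consRank (sideDigit e) r)
      (fun j =>
        let q := finProdFinEquiv.symm (Fin.cast (pow_succ' 3 d) r)
        consRank q.1 (insertRank d j (e ^^ decide (Odd (q.1 : ℕ))) q.2)) i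

theorem insertRank_zero {d : ℕ} (e : Bool) (r : Fin (3 ^ d)) :
    insertRank d 0 e r = consRank (sideDigit e) r := by
  cases d <;> rfl

theorem insertRank_succ {d : ℕ} (i : Fin (d + 1)) (e : Bool) (x : Fin 3) (q : Fin (3 ^ d)) :
    insertRank (d + 1) i.succ e (consRank x q) =
      consRank x (insertRank d i (e ^^ decide (Odd (x : ℕ))) q) := by
  simp only [insertRank, consRank_symm, Fin.cases_succ]

theorem insertRank_strictMono (d : ℕ) (i : Fin (d + 1)) (e : Bool) :
    StrictMono (insertRank d i e) := by
  induction d generalizing e with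
  | zero =>
    intro r s h
    have hr := r.2
    have hs := s.2
    simp only [pow_zero] at hr hs
    rw [Fin.lt_def] at h
    omega
  | succ d ih =>
    intro r s h
    refine Fin.cases ?_ (fun j => ?_) i
    · rw [insertRank_zero, insertRank_zero, consRank_lt_iff]
      exact Or.inr ⟨rfl, h⟩
    · obtain ⟨x, q, rfl⟩ := exists_consRank r
      obtain ⟨y, p, rfl⟩ := exists_consRank s
      rw [insertRank_succ, insertRank_succ, consRank_lt_iff]
      rcases consRank_lt_iff.1 h with h' | ⟨rfl, h'⟩
      · exact Or.inl h'
      · exact Or.inr ⟨rfl, ih j _ h'⟩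

theorem rev_sideDigit (e : Bool) : (sideDigit e).rev = sideDigit (!e) := by
  cases e <;> rfl

/-- Inserting the digit inserts a coordinate into the location of the cell: as the inserted digit is
even, the reversals within the Gray code are not affected. -/
theorem grayCode_insertRank {d : ℕ} (i : Fin (d + 1)) (e : Bool) (r : Fin (3 ^ d)) :
    grayCode 3 (d + 1) (insertRank d i e r) =
      i.insertNth (α := fun _ => Fin 3) (sideDigit e) (grayCode 3 d r) := by
  have hzero : ∀ (d : ℕ) (e : Bool) (r : Fin (3 ^ d)),
      grayCode 3 (d + 1) (insertRank d 0 e r) =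
        (0 : Fin (d + 1)).insertNth (α := fun _ => Fin 3) (sideDigit e) (grayCode 3 d r) := by
    intro d e r
    have : ¬ Odd (sideDigit e : ℕ) := by cases e <;> decide
    rw [insertRank_zero, grayCode_consRank, if_neg this, Fin.insertNth_zero']
  induction d generalizing e with
  | zero => rw [Fin.fin_one_eq_zero i]; exact hzero _ _ _
  | succ d ih =>
    refine Fin.cases (hzero _ _ _) (fun i => ?_) i
    obtain ⟨x, q, rfl⟩ := exists_consRank r
    rw [insertRank_succ]
    rw [Fin.eq_insertNth_iff]
    constructor
    · rw [grayCode_consRank_succ, ih]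
      by_cases hx : Odd (x : ℕ) <;> simp [hx, rev_sideDigit]
    · ext j : 1
      simp only [Fin.removeNth]
      refine Fin.cases ?_ (fun j => ?_) j
      · simp [grayCode_consRank]
      · rw [Fin.succ_succAbove_succ, grayCode_consRank_succ, grayCode_consRank_succ, ih]
        simp

/-- The inserted digit is even; whether it is `0` or `2` depends on the parity of the digits before
position `i`. -/
theorem digit_insertRank {d : ℕ} (i : Fin (d + 1)) (e : Bool) (r : Fin (3 ^ d)) :
    ∃ v : ℕ, (v = 0 ∨ v = 2) ∧ digit 3 (insertRank d i e r) =
      i.insertNth (α := fun _ => ℕ) v (digit 3 r) := by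
  have hzero : ∀ (d : ℕ) (e : Bool) (r : Fin (3 ^ d)),
      ∃ v : ℕ, (v = 0 ∨ v = 2) ∧ digit 3 (insertRank d 0 e r) =
        (0 : Fin (d + 1)).insertNth (α := fun _ => ℕ) v (digit 3 r) := by
    intro d e r
    refine ⟨sideDigit e, by cases e <;> decide, ?_⟩
    rw [insertRank_zero, Fin.insertNth_zero']
    ext j : 1
    refine Fin.cases ?_ (fun j => ?_) j
    · simp [digit_consRank_zero]
    · simp [digit_consRank_succ]
  induction d generalizing e with
  | zero => rw [Fin.fin_one_eq_zero i]; exact hzero _ _ _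
  | succ d ih =>
    refine Fin.cases (hzero _ _ _) (fun i => ?_) i
    obtain ⟨x, q, rfl⟩ := exists_consRank r
    obtain ⟨v, hv, h⟩ := ih i (e ^^ decide (Odd (x : ℕ))) q
    refine ⟨v, hv, ?_⟩
    rw [insertRank_succ, Fin.eq_insertNth_iff]
    constructor
    · rw [digit_consRank_succ, h]; simp
    · ext j : 1
      simp only [Fin.removeNth]
      refine Fin.cases ?_ (fun j => ?_) j
      · simp [digit_consRank_zero]
      · rw [Fin.succ_succAbove_succ, digit_consRank_succ, digit_consRank_succ, h]
        simp

theorem sum_digit_insertRank_mod_two {d : ℕ} (i : Fin (d + 1)) (e : Bool) (r : Fin (3 ^ d)) :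
    (∑ j, digit 3 (insertRank d i e r) j) % 2 = (∑ j, digit 3 r j) % 2 := by
  obtain ⟨v, hv, h⟩ := digit_insertRank i e r
  rw [h, Fin.sum_univ_succAbove _ i]
  simp only [Fin.insertNth_apply_same, Fin.insertNth_apply_succAbove]
  omega

theorem odd_insertRank {d : ℕ} (i : Fin (d + 1)) (e : Bool) (r : Fin (3 ^ d)) :
    Odd (insertRank d i e r : ℕ) ↔ Odd (r : ℕ) := by
  rw [Nat.odd_iff, Nat.odd_iff, ← sum_digit_mod_two, ← sum_digit_mod_two,
    sum_digit_insertRank_mod_two]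

theorem reflect_insertRank {d : ℕ} (i : Fin (d + 1)) (e : Bool) (r : Fin (3 ^ d)) (j : Fin d) :
    reflect (insertRank d i e r) (i.succAbove j) = reflect r j := by
  have h1 := digit_le_sum (insertRank d i e r) (i.succAbove j)
  have h2 := digit_le_sum r j
  have h3 := sum_digit_insertRank_mod_two i e r
  have h4 : digit 3 (insertRank d i e r) (i.succAbove j) = digit 3 r j := by
    obtain ⟨v, -, h⟩ := digit_insertRank i e r
    rw [h]; simp
  simp only [reflect, decide_eq_decide]
  omega

/-! ### Sequences of ranks as codes of parameters and of points -/

theorem dist_cube_le_one {d : ℕ} (p q : Cube d) : dist p q ≤ 1 := by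
  rw [dist_pi_le_iff zero_le_one]
  intro i
  rw [Subtype.dist_eq, Real.dist_eq, abs_le]
  constructor <;> linarith [(p i).2.1, (p i).2.2, (q i).2.1, (q i).2.2]

/-- Placing a pattern in a subcube is a contraction by the factor three. -/
theorem dist_place_le {d : ℕ} (c : Fin d → Fin 3) (a : Fin d → Fin d) (m : Fin d → Bool)
    (p q : Cube d) : dist (place c a m p) (place c a m q) ≤ dist p q / 3 := by
  rw [dist_pi_le_iff (by positivity)]
  intro i
  have h := dist_le_pi_dist p q (a i)
  rw [Subtype.dist_eq, Real.dist_eq] at h ⊢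
  have h3 : |((place c a m p i : unitInterval) : ℝ) - (place c a m q i : unitInterval)| =
      |(p (a i) : ℝ) - q (a i)| / 3 := by
    simp only [place]
    rw [← sub_div, abs_div]
    cases m i
    · simp
    · simp [abs_sub_comm]
  rw [h3]
  linarith

/-- Two families of points agree if their distance at `x` is at most a third of their distance at
`σ x`. This is how points that satisfy the same recursion along codes are identified. -/
theorem eq_of_contracting {X : Type*} {d : ℕ} (σ : X → X) (F G : X → Cube d)
    (h : ∀ x, dist (F x) (G x) ≤ dist (F (σ x)) (G (σ x)) / 3) : F = G := by
  have key : ∀ (n : ℕ) (x : X), dist (F x) (G x) ≤ (1 / 3 : ℝ) ^ n := by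
    intro n
    induction n with
    | zero => intro x; simpa using dist_cube_le_one _ _
    | succ n ih =>
      intro x
      have := ih (σ x)
      rw [pow_succ]
      linarith [h x]
  funext x
  rw [← dist_le_zero]
  exact ge_of_tendsto' (tendsto_pow_atTop_nhds_zero_of_lt_one (by norm_num) (by norm_num))
    fun n => key n x

section Code

variable {d : ℕ} (a : Fin (3 ^ d) → Equiv.Perm (Fin d))

/-- The map that places the pattern in the grid cell of rank `r`. -/
noncomputable def subcell (r : Fin (3 ^ d)) : Cube d → Cube d :=
  place (grayCode 3 d r) (a r) (reflect r)

theorem dist_subcell_le (r : Fin (3 ^ d)) (p q : Cube d) :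
    dist (subcell a r p) (subcell a r q) ≤ dist p q / 3 := dist_place_le _ _ _ _ _

theorem continuous_subcell (r : Fin (3 ^ d)) : Continuous (subcell a r) := by
  refine (LipschitzWith.of_dist_le_mul (K := 1 / 3) fun p q => ?_).continuous
  have := dist_subcell_le a r p q
  simp only [NNReal.coe_div, NNReal.coe_one, NNReal.coe_ofNat]
  linarith

/-- The approximation of depth `l` to the point coded by `s`: the image of the origin under the
first `l` placements. -/
noncomputable def approx : ℕ → (ℕ → Fin (3 ^ d)) → Cube d
  | 0, _ => fun _ => 0
  | l + 1, s => subcell a (s 0) (approx l fun n => s (n + 1))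

theorem dist_approx_le (l : ℕ) (s : ℕ → Fin (3 ^ d)) :
    dist (approx a l s) (approx a (l + 1) s) ≤ 1 * (1 / 3 : ℝ) ^ l := by
  induction l generalizing s with
  | zero => simpa using dist_cube_le_one _ _
  | succ l ih =>
    have h1 := ih fun n => s (n + 1)
    have h2 := dist_subcell_le a (s 0) (approx a l fun n => s (n + 1))
      (approx a (l + 1) fun n => s (n + 1))
    rw [pow_succ]
    refine h2.trans ?_
    linarith

theorem exists_tendsto_approx (s : ℕ → Fin (3 ^ d)) :
    ∃ p, Tendsto (fun l => approx a l s) atTop (𝓝 p) :=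
  cauchySeq_tendsto_of_complete
    (cauchySeq_of_le_geometric (1 / 3) 1 (by norm_num) fun l => dist_approx_le a l s)

/-- The point coded by the sequence `s` of ranks: the common point of the nested cells of ranks
`s 0`, `s 1`, … -/
noncomputable def codedPoint (s : ℕ → Fin (3 ^ d)) : Cube d :=
  (exists_tendsto_approx a s).choose

theorem codedPoint_eq (s : ℕ → Fin (3 ^ d)) :
    codedPoint a s = subcell a (s 0) (codedPoint a fun n => s (n + 1)) := by
  have h1 := (exists_tendsto_approx a s).choose_spec
  have h2 := (exists_tendsto_approx a fun n => s (n + 1)).choose_spec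
  exact tendsto_nhds_unique ((tendsto_add_atTop_iff_nat 1).2 h1)
    (((continuous_subcell a (s 0)).tendsto _).comp h2)

theorem exists_subcell_eq (p : Cube d) : ∃ r q, subcell a r q = p := by
  have hc : ∀ i, ∃ c : Fin 3, (c : ℝ) ≤ 3 * (p i : ℝ) ∧ 3 * (p i : ℝ) ≤ c + 1 := by
    intro i
    have h0 := (p i).2.1
    have h1 := (p i).2.2
    rcases le_total (3 * (p i : ℝ)) 1 with h | h
    · exact ⟨0, by simpa using h0, by simpa using h⟩
    rcases le_total (3 * (p i : ℝ)) 2 with h' | h'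
    · exact ⟨1, by simpa using h, by norm_num; linarith⟩
    · exact ⟨2, by simpa using h', by norm_num; linarith⟩
  choose c hc0 hc1 using hc
  -- undo the placement in the cell with corner `c / 3`
  obtain ⟨r, hr⟩ := (grayCode_bijective 3 d).2 c
  refine ⟨r, fun i => ⟨if reflect r ((a r).symm i) then
    1 - (3 * (p ((a r).symm i) : ℝ) - c ((a r).symm i)) else
      3 * (p ((a r).symm i) : ℝ) - c ((a r).symm i), ?_⟩, ?_⟩
  · have h0 := hc0 ((a r).symm i)
    have h1 := hc1 ((a r).symm i)
    split_ifs <;> constructor <;> linarith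
  · funext i
    apply Subtype.ext
    simp only [subcell, place, hr, Equiv.symm_apply_apply]
    split_ifs <;> push_cast <;> ring

/-- A code of `p` lists the ranks of cells that contain `p`, found by blowing up one such cell in
every step. -/
theorem codedPoint_surjective : Function.Surjective (codedPoint a) := by
  choose r q h using exists_subcell_eq a
  intro p
  refine ⟨fun n => r (q^[n] p), ?_⟩
  have := eq_of_contracting q (fun p => codedPoint a fun n => r (q^[n] p)) id fun p => by
    rw [codedPoint_eq]
    simp only [Function.iterate_zero, id, Function.iterate_succ_apply]
    conv_lhs => rw [← h p]
    have := dist_subcell_le a (r p) (codedPoint a fun n => r (q^[n] (q p))) (q p)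
    rwa [h p] at this ⊢
  exact congrFun this p

end Code

/-! ### Prefixes of sequences and parameter intervals -/

/-- The number that the first `l` digits of `s` represent, with `s 0` the most significant one: the
number of the interval, and of the cell, of depth `l` that `s` runs through. -/
def prefixRank {b : ℕ} : (l : ℕ) → (ℕ → Fin b) → Fin (b ^ l)
  | 0, _ => ⟨0, by simp⟩
  | l + 1, s => consRank (s 0) (prefixRank l fun n => s (n + 1))

theorem ofDigits_eq {b : ℕ} (s : ℕ → Fin b) :
    Real.ofDigits s = ((s 0 : ℕ) + Real.ofDigits fun n => s (n + 1)) / b := by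
  rw [Real.ofDigits_eq_sum_add_ofDigits s 1]
  simp [Real.ofDigitsTerm]
  ring

theorem prefixRank_le_ofDigits {b : ℕ} (l : ℕ) (s : ℕ → Fin b) :
    ((prefixRank l s : ℕ) : ℝ) / (b : ℝ) ^ l ≤ Real.ofDigits s ∧
      Real.ofDigits s ≤ ((prefixRank l s : ℕ) + 1 : ℝ) / (b : ℝ) ^ l := by
  have hb : (0 : ℝ) < b := by exact_mod_cast (s 0).pos
  induction l generalizing s with
  | zero => simp [prefixRank, Real.ofDigits_nonneg, Real.ofDigits_le_one]
  | succ l ih =>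
    obtain ⟨h1, h2⟩ := ih fun n => s (n + 1)
    rw [div_le_iff₀ (by positivity)] at h1
    rw [le_div_iff₀ (by positivity)] at h2
    rw [ofDigits_eq s, prefixRank, consRank_val, div_le_div_iff₀ (by positivity) hb,
      div_le_div_iff₀ hb (by positivity), pow_succ]
    push_cast
    constructor <;> nlinarith

/-- Every parameter in an interval, its end points included, has a code that runs through that
interval. -/
theorem exists_prefixRank_ofDigits {b : ℕ} (hb : 1 < b) (l : ℕ) (n : Fin (b ^ l)) (t : ℝ)
    (h1 : ((n : ℕ) : ℝ) / (b : ℝ) ^ l ≤ t) (h2 : t ≤ ((n : ℕ) + 1 : ℝ) / (b : ℝ) ^ l) :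
    ∃ s : ℕ → Fin b, prefixRank l s = n ∧ Real.ofDigits s = t := by
  have hb' : (0 : ℝ) < b := by exact_mod_cast hb.le
  induction l generalizing t with
  | zero =>
    have hn : (n : ℕ) = 0 := by have := n.2; simp only [pow_zero] at this; omega
    simp only [hn, pow_zero, div_one, Nat.cast_zero, zero_add] at h1 h2
    obtain ⟨s, -, hs⟩ := Real.ofDigits_SurjOn hb ⟨h1, h2⟩
    exact ⟨s, Fin.ext (by simp [prefixRank, hn]), hs⟩
  | succ l ih =>
    obtain ⟨x, q, rfl⟩ := exists_consRank n
    rw [consRank_val, div_le_iff₀ (by positivity), pow_succ] at h1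
    rw [consRank_val, le_div_iff₀ (by positivity), pow_succ] at h2
    push_cast at h1 h2
    obtain ⟨s, hs, hst⟩ := ih q (b * t - x) (by rw [div_le_iff₀ (by positivity)]; nlinarith)
      (by rw [le_div_iff₀ (by positivity)]; nlinarith)
    refine ⟨fun n => Nat.casesOn n x s, ?_, ?_⟩
    · simp [prefixRank, hs]
    · rw [ofDigits_eq]
      change ((x : ℕ) + Real.ofDigits s) / (b : ℝ) = t
      rw [hst]
      field_simp
      ring

/-- Sequences whose values are closer than one interval of depth `l` run through the same or
neighbouring intervals of that depth. -/
theorem prefixRank_le_add_one {b : ℕ} (l : ℕ) (s s' : ℕ → Fin b)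
    (h : Real.ofDigits s < Real.ofDigits s' + 1 / (b : ℝ) ^ l) :
    (prefixRank l s : ℕ) ≤ prefixRank l s' + 1 := by
  have hb : (0 : ℝ) < b := by exact_mod_cast (s 0).pos
  have h1 := (prefixRank_le_ofDigits l s).1
  have h2 := (prefixRank_le_ofDigits l s').2
  have h3 : ((prefixRank l s : ℕ) : ℝ) / (b : ℝ) ^ l <
      ((prefixRank l s' : ℕ) + 1 + 1 : ℝ) / (b : ℝ) ^ l := by
    rw [add_div _ 1 ((b : ℝ) ^ l)]
    linarith
  rw [div_lt_div_iff_of_pos_right (by positivity)] at h3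
  have : (prefixRank l s : ℕ) < prefixRank l s' + 1 + 1 := by exact_mod_cast h3
  omega

theorem prefixRank_mono {b : ℕ} (l : ℕ) (s s' : ℕ → Fin b)
    (h : Real.ofDigits s < Real.ofDigits s') : prefixRank l s ≤ prefixRank l s' := by
  have hb : (0 : ℝ) < b := by exact_mod_cast (s 0).pos
  have h1 := (prefixRank_le_ofDigits l s).1
  have h2 := (prefixRank_le_ofDigits l s').2
  have h3 := (h1.trans_lt h).trans_le h2
  rw [div_lt_div_iff_of_pos_right (by positivity)] at h3
  have : (prefixRank l s : ℕ) < prefixRank l s' + 1 := by exact_mod_cast h3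
  exact Fin.le_def.2 (by omega)

/-! ### Cells -/

section Cells

variable {d : ℕ} (a : Fin (3 ^ d) → Equiv.Perm (Fin d))

theorem cell_consRank (l : ℕ) (r : Fin (3 ^ d)) (n : Fin ((3 ^ d) ^ l)) :
    (wunderlich d a).cell (l + 1) () (consRank r n) =
      subcell a r '' (wunderlich d a).cell l () n := by
  simp only [RegularRuleSystem.cell, consRank_symm]
  rfl

theorem codedPoint_mem_cell (l : ℕ) (s : ℕ → Fin (3 ^ d)) :
    codedPoint a s ∈ (wunderlich d a).cell l () (prefixRank l s) := by
  induction l generalizing s with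
  | zero => exact mem_univ _
  | succ l ih =>
    rw [prefixRank, cell_consRank, codedPoint_eq]
    exact mem_image_of_mem _ (ih _)

theorem exists_codedPoint_of_mem_cell (l : ℕ) (n : Fin ((3 ^ d) ^ l)) (p : Cube d)
    (hp : p ∈ (wunderlich d a).cell l () n) :
    ∃ s, prefixRank l s = n ∧ codedPoint a s = p := by
  induction l generalizing p with
  | zero =>
    obtain ⟨s, hs⟩ := codedPoint_surjective a p
    have hn : (n : ℕ) = 0 := by have := n.2; simp only [pow_zero] at this; omega
    exact ⟨s, Fin.ext (by simp [prefixRank, hn]), hs⟩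
  | succ l ih =>
    obtain ⟨r, q, rfl⟩ := exists_consRank n
    rw [cell_consRank] at hp
    obtain ⟨p, hp, rfl⟩ := hp
    obtain ⟨s, hs, rfl⟩ := ih q p hp
    refine ⟨fun n => Nat.casesOn n r s, ?_, ?_⟩
    · simp [prefixRank, hs]
    · exact codedPoint_eq a _

theorem dist_le_of_mem_cell (l : ℕ) (n : Fin ((3 ^ d) ^ l)) (p q : Cube d)
    (hp : p ∈ (wunderlich d a).cell l () n) (hq : q ∈ (wunderlich d a).cell l () n) :
    dist p q ≤ (1 / 3 : ℝ) ^ l := by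
  induction l generalizing p q with
  | zero => simpa using dist_cube_le_one _ _
  | succ l ih =>
    obtain ⟨r, m, rfl⟩ := exists_consRank n
    rw [cell_consRank] at hp hq
    obtain ⟨p, hp, rfl⟩ := hp
    obtain ⟨q, hq, rfl⟩ := hq
    have := ih m p q hp hq
    have := dist_subcell_le a r p q
    rw [pow_succ]
    linarith

theorem subcell_zero_val (r : Fin (3 ^ d)) (i : Fin d) :
    (subcell a r (fun _ => 0) i : ℝ) = entryCorner r i / 3 := by
  simp only [subcell, place, entryCorner]
  split_ifs <;> simp

theorem subcell_one_val (r : Fin (3 ^ d)) (i : Fin d) :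
    (subcell a r (fun _ => 1) i : ℝ) = exitCorner r i / 3 := by
  simp only [subcell, place, exitCorner]
  split_ifs <;> simp

theorem zero_mem_cell (l : ℕ) (n : Fin ((3 ^ d) ^ l)) (hn : (n : ℕ) = 0) :
    (fun _ => 0) ∈ (wunderlich d a).cell l () n := by
  induction l with
  | zero => exact mem_univ _
  | succ l ih =>
    obtain ⟨r, m, rfl⟩ := exists_consRank n
    rw [consRank_val, Nat.add_eq_zero_iff, mul_eq_zero] at hn
    have hr : (r : ℕ) = 0 := hn.2.resolve_left (by positivity)
    rw [cell_consRank]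
    refine ⟨_, ih m hn.1, ?_⟩
    funext i
    apply Subtype.ext
    rw [subcell_zero_val, entryCorner_first r hr]
    simp

theorem one_mem_cell (l : ℕ) (n : Fin ((3 ^ d) ^ l)) (hn : (n : ℕ) + 1 = (3 ^ d) ^ l) :
    (fun _ => 1) ∈ (wunderlich d a).cell l () n := by
  induction l with
  | zero => exact mem_univ _
  | succ l ih =>
    obtain ⟨r, m, rfl⟩ := exists_consRank n
    obtain ⟨hr, hm⟩ := consRank_last hn
    rw [cell_consRank]
    refine ⟨_, ih m hm, ?_⟩
    funext i
    apply Subtype.ext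
    rw [subcell_one_val, exitCorner_last r hr]
    simp

/-- Consecutive cells of the same depth share a point. -/
theorem cell_inter_nonempty (l : ℕ) (n m : Fin ((3 ^ d) ^ l)) (h : (n : ℕ) + 1 = m) :
    ((wunderlich d a).cell l () n ∩ (wunderlich d a).cell l () m).Nonempty := by
  induction l with
  | zero => exact ⟨fun _ => 0, mem_univ _, mem_univ _⟩
  | succ l ih =>
    obtain ⟨x, q, rfl⟩ := exists_consRank n
    obtain ⟨y, p, rfl⟩ := exists_consRank m
    rw [cell_consRank, cell_consRank]
    rcases consRank_add_one h with ⟨rfl, h'⟩ | ⟨h1, h2, h3⟩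
    · obtain ⟨z, hz1, hz2⟩ := ih q p h'
      exact ⟨subcell a x z, mem_image_of_mem _ hz1, mem_image_of_mem _ hz2⟩
    · refine ⟨subcell a x fun _ => 1, mem_image_of_mem _ (one_mem_cell a l q h2), fun _ => 0,
        zero_mem_cell a l p h3, ?_⟩
      funext i
      apply Subtype.ext
      rw [subcell_one_val, subcell_zero_val, exitCorner_eq_entryCorner x y h1]

theorem isVertexContinuous : (wunderlich d a).IsVertexContinuous := by
  intro l e _ n _ u v hu hv
  exact cell_inter_nonempty a _ _ _ (hu.trans hv.symm)

/-! ### The curve -/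

/-- Parameters that are closer than the width of an interval of depth `l` lie in the same or in
neighbouring intervals, and the corresponding cells share a point. -/
theorem dist_codedPoint_le (l : ℕ) (s s' : ℕ → Fin (3 ^ d))
    (h : |Real.ofDigits s - Real.ofDigits s'| < 1 / ((3 ^ d : ℕ) : ℝ) ^ l) :
    dist (codedPoint a s) (codedPoint a s') ≤ 2 * (1 / 3 : ℝ) ^ l := by
  rw [abs_lt] at h
  have h1 := prefixRank_le_add_one l s s' (by linarith)
  have h2 := prefixRank_le_add_one l s' s (by linarith)
  have hp := codedPoint_mem_cell a l s
  have hq := codedPoint_mem_cell a l s'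
  have key : ∃ z, dist (codedPoint a s) z ≤ (1 / 3 : ℝ) ^ l ∧
      dist (codedPoint a s') z ≤ (1 / 3 : ℝ) ^ l := by
    rcases Nat.lt_trichotomy (prefixRank l s : ℕ) (prefixRank l s') with h | h | h
    · obtain ⟨z, hz, hz'⟩ := cell_inter_nonempty a l (prefixRank l s) (prefixRank l s')
        (by omega)
      exact ⟨z, dist_le_of_mem_cell a l _ _ _ hp hz, dist_le_of_mem_cell a l _ _ _ hq hz'⟩
    · rw [← Fin.ext h] at hq
      exact ⟨codedPoint a s, by simp, dist_le_of_mem_cell a l _ _ _ hq hp⟩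
    · obtain ⟨z, hz, hz'⟩ := cell_inter_nonempty a l (prefixRank l s') (prefixRank l s)
        (by omega)
      exact ⟨z, dist_le_of_mem_cell a l _ _ _ hp hz', dist_le_of_mem_cell a l _ _ _ hq hz⟩
  obtain ⟨z, h1, h2⟩ := key
  linarith [dist_triangle_right (codedPoint a s) (codedPoint a s') z]

/-- Two codes of the same parameter code the same point. -/
theorem codedPoint_eq_of_ofDigits_eq (s s' : ℕ → Fin (3 ^ d))
    (h : Real.ofDigits s = Real.ofDigits s') : codedPoint a s = codedPoint a s' := by
  rw [← dist_le_zero]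
  have : Tendsto (fun l => 2 * (1 / 3 : ℝ) ^ l) atTop (𝓝 (2 * 0)) :=
    (tendsto_pow_atTop_nhds_zero_of_lt_one (by norm_num) (by norm_num)).const_mul 2
  rw [mul_zero] at this
  refine ge_of_tendsto' this fun l => dist_codedPoint_le a l s s' ?_
  rw [h, sub_self, abs_zero]
  positivity

theorem mem_interval_iff {l : ℕ} {n : Fin ((3 ^ d) ^ l)} {t : unitInterval} :
    t ∈ RegularRuleSystem.interval 3 d l n ↔
      ((n : ℕ) : ℝ) / ((3 ^ d : ℕ) : ℝ) ^ l ≤ t ∧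
        (t : ℝ) ≤ ((n : ℕ) + 1 : ℝ) / ((3 ^ d : ℕ) : ℝ) ^ l := by
  simp [RegularRuleSystem.interval]

theorem curve_eq_codedPoint (hd : 1 ≤ d) (s : ℕ → Fin (3 ^ d)) (t : unitInterval)
    (h : Real.ofDigits s = t) : (wunderlich d a).curve t = codedPoint a s := by
  have hb : 1 < 3 ^ d := Nat.one_lt_pow (by omega) (by norm_num)
  have hex : ∀ (l : ℕ) (n : Fin ((3 ^ d) ^ l)), t ∈ RegularRuleSystem.interval 3 d l n →
      codedPoint a s ∈ (wunderlich d a).cell l (wunderlich d a).start n := by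
    intro l n hn
    rw [mem_interval_iff] at hn
    obtain ⟨s', hs', hst⟩ := exists_prefixRank_ofDigits hb l n t hn.1 hn.2
    rw [codedPoint_eq_of_ofDigits_eq a s s' (h.trans hst.symm), ← hs']
    exact codedPoint_mem_cell a l s'
  have hspec := Classical.epsilon_spec (p := fun p : Cube d =>
    ∀ (l : ℕ) (n : Fin ((3 ^ d) ^ l)), t ∈ RegularRuleSystem.interval 3 d l n →
      p ∈ (wunderlich d a).cell l (wunderlich d a).start n) ⟨_, hex⟩
  rw [← dist_le_zero]
  refine ge_of_tendsto' (tendsto_pow_atTop_nhds_zero_of_lt_one (r := (1 / 3 : ℝ)) (by norm_num)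
    (by norm_num)) fun l => ?_
  have ht : t ∈ RegularRuleSystem.interval 3 d l (prefixRank l s) := by
    rw [mem_interval_iff, ← h]
    exact prefixRank_le_ofDigits l s
  exact dist_le_of_mem_cell a l _ _ _ (hspec l _ ht) (hex l _ ht)

theorem exists_ofDigits_eq (hd : 1 ≤ d) (t : unitInterval) :
    ∃ s : ℕ → Fin (3 ^ d), Real.ofDigits s = t := by
  have hb : 1 < 3 ^ d := Nat.one_lt_pow (by omega) (by norm_num)
  obtain ⟨s, -, hs⟩ := Real.ofDigits_SurjOn hb t.2
  exact ⟨s, hs⟩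

theorem curve_ofDigits (hd : 1 ≤ d) (s : ℕ → Fin (3 ^ d)) :
    (wunderlich d a).curve ⟨Real.ofDigits s, Real.ofDigits_nonneg s, Real.ofDigits_le_one s⟩ =
      codedPoint a s :=
  curve_eq_codedPoint a hd s _ rfl

theorem describes_curve (hd : 1 ≤ d) : (wunderlich d a).Describes (wunderlich d a).curve := by
  have hb : 1 < 3 ^ d := Nat.one_lt_pow (by omega) (by norm_num)
  intro l n
  ext p
  constructor
  · rintro ⟨t, ht, rfl⟩
    rw [mem_interval_iff] at ht
    obtain ⟨s, rfl, hs⟩ := exists_prefixRank_ofDigits hb l n t ht.1 ht.2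
    rw [curve_eq_codedPoint a hd s t hs]
    exact codedPoint_mem_cell a l s
  · intro hp
    obtain ⟨s, rfl, rfl⟩ := exists_codedPoint_of_mem_cell a l n p hp
    refine ⟨⟨Real.ofDigits s, Real.ofDigits_nonneg s, Real.ofDigits_le_one s⟩, ?_,
      curve_ofDigits a hd s⟩
    rw [mem_interval_iff]
    exact prefixRank_le_ofDigits l s

theorem curve_surjective (hd : 1 ≤ d) : Function.Surjective (wunderlich d a).curve := by
  intro p
  obtain ⟨s, rfl⟩ := codedPoint_surjective a p
  exact ⟨_, curve_ofDigits a hd s⟩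

theorem continuous_curve (hd : 1 ≤ d) : Continuous (wunderlich d a).curve := by
  rw [Metric.continuous_iff]
  intro t ε hε
  obtain ⟨l, hl⟩ := exists_pow_lt_of_lt_one (show 0 < ε / 2 by positivity)
    (show (1 / 3 : ℝ) < 1 by norm_num)
  refine ⟨1 / ((3 ^ d : ℕ) : ℝ) ^ l, by positivity, fun u hu => ?_⟩
  obtain ⟨s, hs⟩ := exists_ofDigits_eq hd t
  obtain ⟨s', hs'⟩ := exists_ofDigits_eq hd u
  rw [curve_eq_codedPoint a hd s t hs, curve_eq_codedPoint a hd s' u hs']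
  rw [Subtype.dist_eq, Real.dist_eq, ← hs, ← hs'] at hu
  have := dist_codedPoint_le a l s' s hu
  linarith

theorem isSpaceFillingCurve (hd : 1 ≤ d) : IsSpaceFillingCurve (wunderlich d a).curve :=
  ⟨continuous_curve a hd, curve_surjective a hd⟩

end Cells

/-! ### Curves that trace lower-dimensional curves -/

/-- `f` runs through the image of `f'` under `ι` in the order in which `f'` runs through the cube.
The change of parameter need not be continuous or strictly monotone. -/
def Traces {d d' : ℕ} (f : unitInterval → Cube d) (f' : unitInterval → Cube d')
    (ι : Cube d' → Cube d) : Prop :=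
  ∃ φ : unitInterval → unitInterval, Monotone φ ∧ ∀ t, f (φ t) = ι (f' t)

theorem Traces.comp {d d' d'' : ℕ} {f : unitInterval → Cube d} {f' : unitInterval → Cube d'}
    {f'' : unitInterval → Cube d''} {ι : Cube d' → Cube d} {ι' : Cube d'' → Cube d'}
    (h : Traces f f' ι) (h' : Traces f' f'' ι') : Traces f f'' (ι ∘ ι') := by
  obtain ⟨φ, hφ, hf⟩ := h
  obtain ⟨φ', hφ', hf'⟩ := h'
  exact ⟨φ ∘ φ', hφ.comp hφ', fun t => by simp [hf, hf']⟩

/-- A valid ordering of the traced curve extends to a valid ordering of the tracing curve. Weak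
monotonicity of the change of parameter suffices, because it is injective on the values of a valid
ordering. -/
theorem Traces.exists_isValidOrdering {d d' : ℕ} {f : unitInterval → Cube d}
    {f' : unitInterval → Cube d'} {ι : Cube d' → Cube d} (h : Traces f f' ι)
    (hf : Function.Surjective f) (hι : Function.Injective ι) {g' : Cube d' → unitInterval}
    (hg' : IsValidOrdering f' g') :
    ∃ g, IsValidOrdering f g ∧ ∀ a b, g' a < g' b ↔ g (ι a) < g (ι b) := by
  obtain ⟨φ, hφ, hφf⟩ := h
  have hext : ∀ a, Function.extend ι (φ ∘ g') (Function.surjInv hf) (ι a) = φ (g' a) := fun a =>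
    hι.extend_apply _ _ a
  refine ⟨Function.extend ι (φ ∘ g') (Function.surjInv hf), fun p => ?_, fun a b => ?_⟩
  · by_cases hp : ∃ a, ι a = p
    · obtain ⟨a, rfl⟩ := hp
      rw [hext, hφf, hg' a]
    · rw [Function.extend_apply' _ _ _ hp]
      exact Function.surjInv_eq hf p
  · rw [hext, hext]
    constructor
    · intro hab
      refine (hφ hab.le).lt_of_ne fun heq => hab.ne ?_
      have h1 := hφf (g' a)
      rw [heq, hφf, hg', hg'] at h1
      rw [hι h1]
    · exact fun hab => hφ.reflect_lt hab

/-! ### Tracing on the faces -/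

/-- The rotations of a family of curves are compatible with faces if deleting axis `i` from the
rotation in a cell that touches a face orthogonal to axis `i` yields the rotation in the
corresponding cell of the curve with one dimension less. -/
def IsFaceCompatible (A : (d : ℕ) → Fin (3 ^ d) → Equiv.Perm (Fin d)) : Prop :=
  ∀ (d : ℕ) (i : Fin (d + 1)) (e : Bool) (r : Fin (3 ^ d)) (j : Fin d),
    A (d + 1) (insertRank d i e r) (i.succAbove j) =
      (A (d + 1) (insertRank d i e r) i).succAbove (A d r j)

section Face

variable {d : ℕ} (A : (d : ℕ) → Fin (3 ^ d) → Equiv.Perm (Fin d))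

/-- The embedding of the cube as the face on which coordinate `i` equals `side e`. -/
def faceEmb (i : Fin (d + 1)) (e : Bool) (p : Cube d) : Cube (d + 1) :=
  i.insertNth (α := fun _ => unitInterval) (side e) p

theorem side_xor (e m : Bool) :
    ((sideDigit e : ℕ) + (if m then 1 - (side (e ^^ m) : ℝ) else (side (e ^^ m) : ℝ))) / 3 =
      (side e : ℝ) := by
  cases e <;> cases m <;> norm_num [side, sideDigit]

/-- A cell that touches a face meets it in a face of its own, on which the pattern is placed as in
the corresponding cell of the curve with one dimension less. -/
theorem subcell_faceEmb (hA : IsFaceCompatible A) (i : Fin (d + 1)) (e : Bool) (r : Fin (3 ^ d))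
    (p : Cube d) :
    subcell (A (d + 1)) (insertRank d i e r)
        (faceEmb (A (d + 1) (insertRank d i e r) i) (e ^^ reflect (insertRank d i e r) i) p) =
      faceEmb i e (subcell (A d) r p) := by
  rw [faceEmb, faceEmb, Fin.eq_insertNth_iff]
  constructor
  · apply Subtype.ext
    simp only [subcell, place, grayCode_insertRank, Fin.insertNth_apply_same]
    exact side_xor _ _
  · funext j
    apply Subtype.ext
    simp only [Fin.removeNth, subcell, place, grayCode_insertRank, Fin.insertNth_apply_succAbove,
      hA d i e r j, reflect_insertRank]

/-- The code, for the curve of dimension `d + 1`, of the point that has code `s` on the face where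
coordinate `i` equals `side e`. -/
def faceCode (i : Fin (d + 1)) (e : Bool) (s : ℕ → Fin (3 ^ d)) : ℕ → Fin (3 ^ (d + 1))
  | 0 => insertRank d i e (s 0)
  | n + 1 => faceCode (A (d + 1) (insertRank d i e (s 0)) i)
      (e ^^ reflect (insertRank d i e (s 0)) i) (fun n => s (n + 1)) n

theorem codedPoint_faceCode (hA : IsFaceCompatible A) (i : Fin (d + 1)) (e : Bool)
    (s : ℕ → Fin (3 ^ d)) :
    codedPoint (A (d + 1)) (faceCode A i e s) = faceEmb i e (codedPoint (A d) s) := by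
  have := eq_of_contracting (X := Fin (d + 1) × Bool × (ℕ → Fin (3 ^ d)))
    (fun x => (A (d + 1) (insertRank d x.1 x.2.1 (x.2.2 0)) x.1,
      x.2.1 ^^ reflect (insertRank d x.1 x.2.1 (x.2.2 0)) x.1, fun n => x.2.2 (n + 1)))
    (fun x => codedPoint (A (d + 1)) (faceCode A x.1 x.2.1 x.2.2))
    (fun x => faceEmb x.1 x.2.1 (codedPoint (A d) x.2.2)) fun x => by
      obtain ⟨i, e, s⟩ := x
      simp only
      rw [codedPoint_eq, codedPoint_eq (A d) s, ← subcell_faceEmb A hA]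
      exact dist_subcell_le _ _ _ _
  exact congrFun this (i, e, s)

/-- Codes on a face are translated digit by digit, where the translation of a digit depends only on
the earlier digits and preserves the order; so it is monotone for the lexicographic order. -/
theorem prefixRank_faceCode_mono (l : ℕ) (i : Fin (d + 1)) (e : Bool) (s s' : ℕ → Fin (3 ^ d))
    (h : prefixRank l s ≤ prefixRank l s') :
    prefixRank l (faceCode A i e s) ≤ prefixRank l (faceCode A i e s') := by
  induction l generalizing i e s s' with
  | zero => exact le_rfl
  | succ l ih =>
    rw [prefixRank, prefixRank, ← not_lt, consRank_lt_iff] at h ⊢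
    rintro (h' | ⟨h', h''⟩)
    · exact h (Or.inl ((insertRank_strictMono d i e).lt_iff_lt.1 h'))
    · have h0 : s 0 = s' 0 := ((insertRank_strictMono d i e).injective h').symm
      have h1 := ih (A (d + 1) (insertRank d i e (s 0)) i)
        (e ^^ reflect (insertRank d i e (s 0)) i) (fun n => s (n + 1)) (fun n => s' (n + 1))
        (not_lt.1 fun hlt => h (Or.inr ⟨h0.symm, hlt⟩))
      refine absurd h'' (not_lt.2 ?_)
      simp only [faceCode, ← h0]
      exact h1

theorem ofDigits_faceCode_le (i : Fin (d + 1)) (e : Bool) (s s' : ℕ → Fin (3 ^ d))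
    (h : Real.ofDigits s < Real.ofDigits s') :
    Real.ofDigits (faceCode A i e s) ≤ Real.ofDigits (faceCode A i e s') := by
  have hb : 1 < 3 ^ (d + 1) := Nat.one_lt_pow (by omega) (by norm_num)
  have hb' : (1 : ℝ) < ((3 ^ (d + 1) : ℕ) : ℝ) := by exact_mod_cast hb
  have hlim : Tendsto (fun l : ℕ => Real.ofDigits (faceCode A i e s') +
      (((3 ^ (d + 1) : ℕ) : ℝ)⁻¹) ^ l) atTop (𝓝 (Real.ofDigits (faceCode A i e s') + 0)) :=
    (tendsto_pow_atTop_nhds_zero_of_lt_one (by positivity) (inv_lt_one_of_one_lt₀ hb')).const_add _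
  rw [add_zero] at hlim
  refine ge_of_tendsto' hlim fun l => ?_
  have h1 := prefixRank_faceCode_mono A l i e s s' (prefixRank_mono l s s' h)
  have h2 := (prefixRank_le_ofDigits l (faceCode A i e s)).2
  have h3 := (prefixRank_le_ofDigits l (faceCode A i e s')).1
  have h4 : ((prefixRank l (faceCode A i e s) : ℕ) : ℝ) ≤
      (prefixRank l (faceCode A i e s') : ℕ) := by exact_mod_cast h1
  have h5 : ((prefixRank l (faceCode A i e s) : ℕ) : ℝ) / ((3 ^ (d + 1) : ℕ) : ℝ) ^ l ≤
      (prefixRank l (faceCode A i e s') : ℕ) / ((3 ^ (d + 1) : ℕ) : ℝ) ^ l := by gcongr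
  rw [add_div, one_div, ← inv_pow] at h2
  linarith

/-- The curve of dimension `d + 1` traces the one of dimension `d` on each face. -/
theorem traces_faceEmb (hA : IsFaceCompatible A) (hd : 1 ≤ d) (i : Fin (d + 1)) (e : Bool) :
    Traces (wunderlich (d + 1) (A (d + 1))).curve (wunderlich d (A d)).curve (faceEmb i e) := by
  -- any choice of codes will do, since smaller parameters have lexicographically smaller codes
  choose s hs using fun t => exists_ofDigits_eq (d := d) hd t
  refine ⟨fun t => ⟨Real.ofDigits (faceCode A i e (s t)), Real.ofDigits_nonneg _,
    Real.ofDigits_le_one _⟩, fun t t' h => ?_, fun t => ?_⟩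
  · rcases h.eq_or_lt with rfl | h
    · exact le_rfl
    · refine Subtype.mk_le_mk.2 (ofDigits_faceCode_le A i e _ _ ?_)
      rw [hs, hs]
      exact h
  · rw [curve_ofDigits _ (by omega), codedPoint_faceCode A hA,
      curve_eq_codedPoint _ hd (s t) t (hs t)]

theorem faceEmb_injective (i : Fin (d + 1)) (e : Bool) : Function.Injective (faceEmb i e) :=
  fun _ _ h => (Fin.insertNth_right_injective (α := fun _ => unitInterval) (side e)) h

end Face

/-! ### Interdimensional consistency -/

theorem lift_injective {d' d : ℕ} {μ : Fin d' → Fin d} (hμ : Function.Injective μ) :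
    Function.Injective (lift μ) := by
  intro p q h
  funext i
  have := congrFun h (μ i)
  rwa [lift, lift, hμ.extend_apply, hμ.extend_apply] at this

theorem lift_succAbove_comp {d' d : ℕ} (i : Fin (d + 1)) {ν : Fin d' → Fin d}
    (hν : Function.Injective ν) :
    lift (i.succAbove ∘ ν) = faceEmb i false ∘ lift ν := by
  have hinj : Function.Injective (i.succAbove ∘ ν) := Fin.succAbove_right_injective.comp hν
  funext p
  refine (Fin.eq_insertNth_iff (α := fun _ => unitInterval)).2 ⟨?_, ?_⟩
  · rw [lift, Function.extend_apply' _ _ _ (by rintro ⟨j, hj⟩; exact Fin.succAbove_ne _ _ hj)]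
    rfl
  · funext j
    rw [Fin.removeNth]
    by_cases hj : ∃ l, ν l = j
    · obtain ⟨l, rfl⟩ := hj
      rw [lift, lift, hν.extend_apply]
      exact hinj.extend_apply p _ l
    · rw [lift, lift, Function.extend_apply' _ _ _ hj, Function.extend_apply']
      rintro ⟨l, hl⟩
      exact hj ⟨l, Fin.succAbove_right_injective hl⟩

/-- The embedding `lift μ` is a composition of embeddings of front faces. -/
theorem traces_lift {A : (d : ℕ) → Fin (3 ^ d) → Equiv.Perm (Fin d)} (hA : IsFaceCompatible A)
    {d' d : ℕ} (hd' : 1 ≤ d') (hd : d' ≤ d) (μ : Fin d' → Fin d) (hμ : StrictMono μ) :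
    Traces (wunderlich d (A d)).curve (wunderlich d' (A d')).curve (lift μ) := by
  induction d, hd using Nat.le_induction with
  | base =>
    have hid : μ = id := by
      have := Subsingleton.elim (hμ.orderIsoOfSurjective μ
        (Finite.surjective_of_injective hμ.injective)) (OrderIso.refl _)
      funext i
      exact congrArg (fun o : Fin d' ≃o Fin d' => o i) this
    refine ⟨id, monotone_id, fun t => funext fun i => ?_⟩
    rw [lift, hid]
    exact (Function.injective_id.extend_apply _ _ i).symm
  | succ d hd ih =>
    -- factor `μ` through the omission of an axis that it does not select
    obtain ⟨i, hi⟩ : ∃ i, i ∉ range μ := by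
      by_contra! h
      have := Fintype.card_le_of_surjective μ h
      simp at this
      omega
    have hne : ∀ j, ∃ l, i.succAbove l = μ j := fun j =>
      Fin.exists_succAbove_eq fun h => hi ⟨j, h⟩
    choose ν hν using hne
    have hμν : μ = i.succAbove ∘ ν := funext fun j => (hν j).symm
    have hνm : StrictMono ν := fun j l h => by
      have := hμ h
      rwa [← hν, ← hν, Fin.succAbove_lt_succAbove_iff] at this
    rw [hμν, lift_succAbove_comp i hνm.injective]
    exact (traces_faceEmb A hA (by omega) i false).comp (ih ν hνm)

theorem isInterdimensionallyConsistent {A : (d : ℕ) → Fin (3 ^ d) → Equiv.Perm (Fin d)}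
    (hA : IsFaceCompatible A) :
    IsInterdimensionallyConsistent fun d => (wunderlich d (A d)).curve :=
  ⟨fun d hd => isSpaceFillingCurve (A d) hd, fun _ _ hd' hlt _ hg' μ hμ =>
    (traces_lift hA hd' hlt.le μ hμ).exists_isValidOrdering (curve_surjective _ (by omega))
      (lift_injective hμ.injective) hg'⟩

/-! ### Face compatibility of the four families -/

theorem isFaceCompatible_one : IsFaceCompatible fun _ _ => 1 := fun _ _ _ _ _ => rfl

theorem isFaceCompatible_rev : IsFaceCompatible fun _ _ => Fin.revPerm := fun _ i _ _ j =>
  Fin.rev_succAbove i j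

theorem isFaceCompatible_parity :
    IsFaceCompatible fun _ r => if Odd (r : ℕ) then 1 else Fin.revPerm := by
  intro d i e r j
  simp only [odd_insertRank]
  split_ifs
  · rfl
  · exact Fin.rev_succAbove i j

/-- The number of digits after digit `i` with a given property. -/
def digitsAfter {d : ℕ} (P : ℕ → Prop) [DecidablePred P] (r : Fin (3 ^ d)) (i : Fin d) : ℕ :=
  (Finset.univ.filter fun j => i < j ∧ P (digit 3 r j)).card

theorem digitsAfter_le {d : ℕ} (P : ℕ → Prop) [DecidablePred P] (r : Fin (3 ^ d)) {i j : Fin d}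
    (hij : i < j) :
    digitsAfter P r j + (if P (digit 3 r j) then 1 else 0) ≤ digitsAfter P r i := by
  have hsub : (Finset.univ.filter fun l => j < l ∧ P (digit 3 r l)) ⊆
      Finset.univ.filter fun l => i < l ∧ P (digit 3 r l) := fun l hl => by
    simp only [Finset.mem_filter, Finset.mem_univ, true_and] at hl ⊢
    exact ⟨hij.trans hl.1, hl.2⟩
  split_ifs with h
  · refine Finset.card_lt_card ((Finset.ssubset_iff_of_subset hsub).2 ⟨j, ?_, ?_⟩)
    · simp [h, hij]
    · simp
  · exact Finset.card_le_card hsub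

/-- An inserted digit `v` is counted at the positions before it. -/
theorem digitsAfter_insertNth {d : ℕ} (P : ℕ → Prop) [DecidablePred P] (R : Fin (3 ^ (d + 1)))
    (r : Fin (3 ^ d)) (i : Fin (d + 1)) (v : ℕ)
    (h : digit 3 R = i.insertNth (α := fun _ => ℕ) v (digit 3 r)) (j : Fin d) :
    digitsAfter P R (i.succAbove j) =
      digitsAfter P r j + if i.succAbove j < i ∧ P v then 1 else 0 := by
  simp only [digitsAfter, Finset.card_filter]
  rw [Fin.sum_univ_succAbove _ i, add_comm]
  simp only [h, Fin.insertNth_apply_same, Fin.insertNth_apply_succAbove,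
    Fin.succAbove_lt_succAbove_iff]

theorem meurtheIndex_eq {d : ℕ} (r : Fin (3 ^ d)) (i : Fin d) :
    meurtheIndex r i = if digit 3 r i = 2 then d - 1 - digitsAfter (· = 2) r i
      else digitsAfter (fun x => x = 0 ∨ x = 1) r i := rfl

/-- Let `x` be the axis `a_i`. Deleting digit `i` lowers by one the counts of its kind (twos, or
zeros and ones) for the digits before it. A low digit before `i` has an axis above `x` and one
after `i` an axis below `x` if digit `i` is low itself, and all twos then have axes above `x`; the
situation is symmetric if digit `i` is a two. -/
theorem isFaceCompatible_meurthe :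
    IsFaceCompatible fun _ r => Equiv.ofBijective _ (meurtheIndex_bijective r) := by
  intro d i e r j
  obtain ⟨v, hv, h⟩ := digit_insertRank i e r
  set R := insertRank d i e r
  apply Fin.ext
  have hi : digit 3 R i = v := by rw [h]; simp
  have hj : digit 3 R (i.succAbove j) = digit 3 r j := by rw [h]; simp
  have hdig : digit 3 r j = 0 ∨ digit 3 r j = 1 ∨ digit 3 r j = 2 := by
    have := digit_lt r j
    omega
  have hlo := digitsAfter_insertNth (fun x => x = 0 ∨ x = 1) R r i v h j
  have hhi := digitsAfter_insertNth (· = 2) R r i v h j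
  have haux : digitsAfter (· = 2) R i + digitsAfter (fun x => x = 0 ∨ x = 1) R i =
    d + 1 - 1 - i := meurthe_aux R i
  have hauxj : digitsAfter (· = 2) R (i.succAbove j) +
    digitsAfter (fun x => x = 0 ∨ x = 1) R (i.succAbove j) = d + 1 - 1 - (i.succAbove j : ℕ) :=
      meurthe_aux R (i.succAbove j)
  have hauxr : digitsAfter (· = 2) r j + digitsAfter (fun x => x = 0 ∨ x = 1) r j =
    d - 1 - j := meurthe_aux r j
  have hjd := j.2
  simp only [Equiv.ofBijective_apply, Fin.succAbove, Fin.lt_def, Fin.val_castSucc]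
  rw [apply_ite Fin.val]
  simp only [Fin.val_castSucc, Fin.val_succ]
  change meurtheIndex R (i.succAbove j) = _
  rw [meurtheIndex_eq R, meurtheIndex_eq R, meurtheIndex_eq r, hi, hj]
  rcases lt_or_gt_of_ne (Fin.succAbove_ne i j) with hlt | hlt
  -- digit `j` precedes the inserted digit
  · have h1 := digitsAfter_le (fun x => x = 0 ∨ x = 1) R hlt
    have h2 := digitsAfter_le (· = 2) R hlt
    have hlt' : (i.succAbove j : ℕ) < i := hlt
    simp only [hi, hlt, true_and] at h1 h2 hlo hhi
    rcases hv with rfl | rfl <;> rcases hdig with hr | hr | hr <;>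
      simp [hr] at h1 h2 hlo hhi ⊢ <;> split_ifs <;> omega
  -- digit `j` follows the inserted digit
  · have h1 := digitsAfter_le (fun x => x = 0 ∨ x = 1) R hlt
    have h2 := digitsAfter_le (· = 2) R hlt
    have hlt' : (i : ℕ) < i.succAbove j := hlt
    simp only [hj, hlt.not_gt, false_and, if_false, add_zero] at h1 h2 hlo hhi
    rcases hv with rfl | rfl <;> rcases hdig with hr | hr | hr <;>
      simp [hr] at h1 h2 hlo hhi ⊢ <;> split_ifs <;> omega

/-! ### Parametrization by volume -/

theorem volume_cube_le {d : ℕ} (s : Set (Cube d)) (ε : ℝ) (h : ∀ p ∈ s, ∀ q ∈ s, dist p q ≤ ε) :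
    volume s ≤ ENNReal.ofReal ε ^ d := by
  have hsub : s ⊆ pi univ fun i => (fun p : Cube d => p i) '' s := fun p hp i _ => ⟨p, hp, rfl⟩
  refine (measure_mono hsub).trans ?_
  rw [volume_pi, Measure.pi_pi]
  refine (Finset.prod_le_pow_card _ _ (ENNReal.ofReal ε) fun i _ => ?_).trans (by simp)
  rw [unitInterval.volume_apply]
  refine (Real.volume_le_diam _).trans (Metric.ediam_le ?_)
  rintro _ ⟨_, ⟨p, hp, rfl⟩, rfl⟩ _ ⟨_, ⟨q, hq, rfl⟩, rfl⟩
  have h1 : dist (p i) (q i) ≤ ε := (dist_le_pi_dist p q i).trans (h p hp q hq)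
  rw [edist_dist]
  exact ENNReal.ofReal_le_ofReal h1

/-- At most `y - x + 2` of the intervals `[n, n + 1]` meet `[x, y]`. -/
theorem card_filter_meets_Icc_le {M : ℕ} {x y : ℝ} (hx : 0 ≤ x) (hxy : x ≤ y) :
    ((Finset.univ.filter fun n : Fin M => x ≤ (n : ℕ) + 1 ∧ ((n : ℕ) : ℝ) ≤ y).card : ℝ) ≤
      y - x + 2 := by
  have h1 : (Finset.univ.filter fun n : Fin M => x ≤ (n : ℕ) + 1 ∧ ((n : ℕ) : ℝ) ≤ y).card ≤
      (Finset.Icc (⌈x⌉₊ - 1) ⌊y⌋₊).card := by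
    refine Finset.card_le_card_of_injOn Fin.val (fun n hn => ?_) Fin.val_injective.injOn
    simp only [Finset.coe_filter, Finset.mem_univ, true_and, mem_ofPred_eq] at hn
    simp only [Finset.coe_Icc, mem_Icc]
    have h2 : ⌈x⌉₊ ≤ (n : ℕ) + 1 := Nat.ceil_le.2 (by exact_mod_cast hn.1)
    exact ⟨by omega, Nat.le_floor hn.2⟩
  rw [Nat.card_Icc] at h1
  have h2 : (Finset.univ.filter fun n : Fin M => x ≤ (n : ℕ) + 1 ∧ ((n : ℕ) : ℝ) ≤ y).card +
      ⌈x⌉₊ ≤ ⌊y⌋₊ + 2 ∨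
      (Finset.univ.filter fun n : Fin M => x ≤ (n : ℕ) + 1 ∧ ((n : ℕ) : ℝ) ≤ y).card = 0 := by
    omega
  rcases h2 with h2 | h2
  · have h3 := Nat.floor_le (hx.trans hxy)
    have h4 := Nat.le_ceil x
    have h5 : ((Finset.univ.filter fun n : Fin M => x ≤ (n : ℕ) + 1 ∧ ((n : ℕ) : ℝ) ≤ y).card : ℝ) +
      ⌈x⌉₊ ≤ ⌊y⌋₊ + 2 := by exact_mod_cast h2
    linarith
  · rw [h2]
    push_cast
    linarith

section Volume

variable {d : ℕ} (a : Fin (3 ^ d) → Equiv.Perm (Fin d))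

theorem volume_cell_le (l : ℕ) (n : Fin ((3 ^ d) ^ l)) :
    volume ((wunderlich d a).cell l () n) ≤ ENNReal.ofReal (1 / ((3 ^ d : ℕ) : ℝ) ^ l) := by
  refine (volume_cube_le _ _ fun p hp q hq => dist_le_of_mem_cell a l n p q hp hq).trans ?_
  rw [← ENNReal.ofReal_pow (by positivity)]
  apply le_of_eq
  congr 1
  push_cast
  rw [one_div, one_div, inv_pow, inv_pow, ← pow_mul, ← pow_mul, mul_comm]

/-- The cells whose intervals meet `[s, t]` cover the image; up to the two outermost ones, their
volumes add up to at most `t - s`. -/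
theorem volume_image_Icc_le (hd : 1 ≤ d) (s t : unitInterval) (hst : s ≤ t) :
    volume ((wunderlich d a).curve '' Icc s t) ≤ ENNReal.ofReal ((t : ℝ) - s) := by
  have hst' : (s : ℝ) ≤ t := hst
  have hb : (1 : ℝ) < ((3 ^ d : ℕ) : ℝ) := by
    exact_mod_cast Nat.one_lt_pow (by omega) (by norm_num)
  have hlim : Tendsto (fun l : ℕ => ENNReal.ofReal ((t : ℝ) - s + 2 * (((3 ^ d : ℕ) : ℝ)⁻¹) ^ l))
      atTop (𝓝 (ENNReal.ofReal ((t : ℝ) - s + 2 * 0))) :=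
    ENNReal.tendsto_ofReal (((tendsto_pow_atTop_nhds_zero_of_lt_one (by positivity)
      (inv_lt_one_of_one_lt₀ hb)).const_mul _).const_add _)
  rw [mul_zero, add_zero] at hlim
  refine ge_of_tendsto' hlim fun l => ?_
  set M : ℝ := ((3 ^ d : ℕ) : ℝ) ^ l with hM
  have hM0 : 0 < M := by positivity
  set F := Finset.univ.filter fun n : Fin ((3 ^ d) ^ l) =>
    (s : ℝ) * M ≤ (n : ℕ) + 1 ∧ ((n : ℕ) : ℝ) ≤ t * M with hF
  have hcover : (wunderlich d a).curve '' Icc s t ⊆ ⋃ n ∈ F, (wunderlich d a).cell l () n := by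
    rintro _ ⟨u, hu, rfl⟩
    obtain ⟨c, hc⟩ := exists_ofDigits_eq hd u
    have h1 := prefixRank_le_ofDigits l c
    rw [hc, ← hM, div_le_iff₀ hM0, le_div_iff₀ hM0] at h1
    have hsu : (s : ℝ) * M ≤ u * M := mul_le_mul_of_nonneg_right hu.1 hM0.le
    have hut : (u : ℝ) * M ≤ t * M := mul_le_mul_of_nonneg_right hu.2 hM0.le
    rw [curve_eq_codedPoint a hd c u hc]
    refine mem_iUnion₂.2 ⟨prefixRank l c, ?_, codedPoint_mem_cell a l c⟩
    rw [hF, Finset.mem_filter]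
    exact ⟨Finset.mem_univ _, hsu.trans h1.2, h1.1.trans hut⟩
  calc volume ((wunderlich d a).curve '' Icc s t)
      ≤ ∑ n ∈ F, volume ((wunderlich d a).cell l () n) :=
        (measure_mono hcover).trans (measure_biUnion_finset_le _ _)
    _ ≤ ∑ n ∈ F, ENNReal.ofReal (1 / M) := Finset.sum_le_sum fun n _ => volume_cell_le a l n
    _ = ENNReal.ofReal (F.card * (1 / M)) := by
        rw [Finset.sum_const, nsmul_eq_mul, ENNReal.ofReal_mul (by positivity),
          ENNReal.ofReal_natCast]
    _ ≤ ENNReal.ofReal ((t : ℝ) - s + 2 * (((3 ^ d : ℕ) : ℝ)⁻¹) ^ l) := by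
        apply ENNReal.ofReal_le_ofReal
        have hcard : (F.card : ℝ) ≤ t * M - s * M + 2 :=
          card_filter_meets_Icc_le (mul_nonneg s.2.1 hM0.le)
            (mul_le_mul_of_nonneg_right hst' hM0.le)
        rw [inv_pow, ← hM, mul_one_div, div_le_iff₀ hM0]
        refine hcard.trans (le_of_eq ?_)
        field_simp

/-- Any valid ordering is parametrized by volume: the points that it sends into `[s, t]` lie in
the image of `[s, t]`, the others in the image of `[0, s] ∪ [t, 1]`, and the volumes of these
images add up to at most one. -/
theorem volume_isValidOrdering (hd : 1 ≤ d) {h : Cube d → unitInterval}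
    (hh : IsValidOrdering (wunderlich d a).curve h) (s t : unitInterval) (hst : s ≤ t) :
    NullMeasurableSet {p | h p ∈ Icc s t} (volume : Measure (Cube d)) ∧
      volume {p | h p ∈ Icc s t} = ENNReal.ofReal ((t : ℝ) - (s : ℝ)) := by
  set f := (wunderlich d a).curve
  have hmeas : ∀ u v, MeasurableSet (f '' Icc u v) := fun u v =>
    (isCompact_Icc.image (continuous_curve a hd)).isClosed.measurableSet
  set L := f '' Icc 0 s ∪ f '' Icc t 1
  have hL : MeasurableSet L := (hmeas _ _).union (hmeas _ _)
  have hst' : (s : ℝ) ≤ t := hst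
  have hLvol : volume L ≤ ENNReal.ofReal (1 - ((t : ℝ) - s)) := by
    refine (measure_union_le _ _).trans ((add_le_add (volume_image_Icc_le a hd 0 s s.2.1)
      (volume_image_Icc_le a hd t 1 t.2.2)).trans ?_)
    rw [← ENNReal.ofReal_add (by simpa using s.2.1) (by simpa using t.2.2)]
    apply ENNReal.ofReal_le_ofReal
    simp only [Icc.coe_zero, Icc.coe_one]
    linarith
  have hLc : ENNReal.ofReal ((t : ℝ) - s) ≤ volume Lᶜ := by
    rw [prob_compl_eq_one_sub hL]
    refine le_trans ?_ (tsub_le_tsub_left hLvol 1)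
    rw [← ENNReal.ofReal_one, ← ENNReal.ofReal_sub _ (by linarith [s.2.1, t.2.2])]
    apply ENNReal.ofReal_le_ofReal
    linarith
  have hsub : Lᶜ ⊆ {p | h p ∈ Icc s t} := by
    intro p hp
    simp only [L, mem_compl_iff, mem_union, not_or] at hp
    refine ⟨le_of_not_ge fun hlt => hp.1 ⟨h p, ⟨(h p).2.1, hlt⟩, hh p⟩,
      le_of_not_ge fun hlt => hp.2 ⟨h p, ⟨hlt, (h p).2.2⟩, hh p⟩⟩
  have hsub' : {p | h p ∈ Icc s t} ⊆ f '' Icc s t := fun p hp => ⟨h p, hp, hh p⟩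
  have hle : volume {p | h p ∈ Icc s t} ≤ ENNReal.ofReal ((t : ℝ) - s) :=
    (measure_mono hsub').trans (volume_image_Icc_le a hd s t hst)
  have hae : (Lᶜ : Set (Cube d)) =ᵐ[volume] {p | h p ∈ Icc s t} :=
    ae_eq_of_subset_of_measure_ge hsub (hle.trans hLc) hL.compl.nullMeasurableSet
      (measure_ne_top _ _)
  exact ⟨hL.compl.nullMeasurableSet.congr hae, hle.antisymm (hLc.trans (measure_mono hsub))⟩

end Volume

theorem showsOnFace {A : (d : ℕ) → Fin (3 ^ d) → Equiv.Perm (Fin d)} (hA : IsFaceCompatible A)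
    {d : ℕ} (hd : 1 ≤ d) (i : Fin (d + 1)) (e : Bool) :
    ShowsOnFace (wunderlich (d + 1) (A (d + 1))).curve (wunderlich d (A d)).curve i (side e) := by
  intro h hh
  obtain ⟨g, hg, hgh⟩ := (traces_faceEmb A hA hd i e).exists_isValidOrdering
    (curve_surjective _ (by omega)) (faceEmb_injective i e) hh
  refine ⟨g, hg, fun p hp q hq => ?_, volume_isValidOrdering (A d) hd hh⟩
  have hface : ∀ p ∈ face i (side e), faceEmb i e (i.removeNth p) = p := by
    intro p hp
    have hp' : p i = side e := hp
    rw [faceEmb, ← hp', Fin.insertNth_self_removeNth]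
  rw [hgh, hface p hp, hface q hq]

/-! ### Equidistribution of a random walk on a finite group -/

section Walk

variable {G : Type*} [Group G] {M : ℕ} {σ : Fin M → G} {p : ℕ → G → ℝ}

theorem le_of_walk (hp : ∀ l g, p (l + 1) g = (∑ r, p l ((σ r)⁻¹ * g)) / M) (hM : 0 < M)
    {l : ℕ} {B : ℝ} (hB : ∀ g, p l g ≤ B) (k : ℕ) (g : G) : p (l + k) g ≤ B := by
  induction k generalizing g with
  | zero => exact hB g
  | succ k ih =>
    rw [← add_assoc, hp, div_le_iff₀ (by positivity)]
    refine (Finset.sum_le_sum fun r _ => ih _).trans (le_of_eq ?_)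
    simp [mul_comm]

theorem ge_of_walk (hp : ∀ l g, p (l + 1) g = (∑ r, p l ((σ r)⁻¹ * g)) / M) (hM : 0 < M)
    {l : ℕ} {b : ℝ} (hb : ∀ g, b ≤ p l g) (k : ℕ) (g : G) : b ≤ p (l + k) g := by
  have := le_of_walk (p := fun l g => -p l g) (σ := σ) (M := M)
    (fun l g => by simp [hp, neg_div]) hM (l := l) (B := -b) (fun g => neg_le_neg (hb g)) k g
  exact neg_le_neg_iff.1 this

/-- A deficit of `p l` at `g` below an upper bound `B` spreads to all elements that are reached
from `g` by a word `w`, at the cost of a factor `M` per step. -/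
theorem walk_word_le (hp : ∀ l g, p (l + 1) g = (∑ r, p l ((σ r)⁻¹ * g)) / M) (hM : 0 < M)
    {l : ℕ} {B : ℝ} (hB : ∀ g, p l g ≤ B) (w : List (Fin M)) (g : G) :
    p (l + w.length) ((w.map σ).prod * g) ≤ B - (B - p l g) / (M : ℝ) ^ w.length := by
  have hM' : (0 : ℝ) < M := by exact_mod_cast hM
  induction w with
  | nil => simp
  | cons r w ih =>
    have h1 : ∑ x, (B - p (l + w.length) ((σ x)⁻¹ * ((σ r) * ((w.map σ).prod * g)))) ≥
        B - p (l + w.length) ((w.map σ).prod * g) := by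
      have := Finset.single_le_sum
        (f := fun x => B - p (l + w.length) ((σ x)⁻¹ * ((σ r) * ((w.map σ).prod * g))))
        (fun x _ => sub_nonneg.2 (le_of_walk hp hM hB _ _)) (Finset.mem_univ r)
      simpa using this
    rw [Finset.sum_sub_distrib] at h1
    simp only [Finset.sum_const, Finset.card_univ, Fintype.card_fin, nsmul_eq_mul] at h1
    rw [List.length_cons, ← add_assoc, hp, List.map_cons, List.prod_cons, mul_assoc,
      div_le_iff₀ hM', pow_succ, sub_mul, ← div_div, div_mul_cancel₀ _ hM'.ne']
    linarith

/-- If the steps generate the group and one of them is trivial, then all elements are products of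
the same number of steps. -/
theorem exists_uniform_word_length [Finite G] (h1 : ∃ r, σ r = 1)
    (hgen : Subgroup.closure (range σ) = ⊤) :
    ∃ m, ∀ g, ∃ w : List (Fin M), w.length = m ∧ (w.map σ).prod = g := by
  have hw : ∀ g, ∃ w : List (Fin M), (w.map σ).prod = g := by
    intro g
    have hg : g ∈ Submonoid.closure (range σ) := by
      rw [← Subgroup.closure_toSubmonoid_of_finite, hgen]
      exact Subgroup.mem_top g
    obtain ⟨L, hL, rfl⟩ := Submonoid.exists_list_of_mem_closure hg
    obtain ⟨w, rfl⟩ : L ∈ range (List.map σ) := by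
      rw [Set.range_list_map]
      exact hL
    exact ⟨w, rfl⟩
  choose w hw using hw
  -- pad all words with the trivial step to the length of the longest one
  obtain ⟨r, hr⟩ := h1
  obtain ⟨m, hm⟩ := (finite_range fun g => (w g).length).bddAbove
  refine ⟨m, fun g => ⟨w g ++ List.replicate (m - (w g).length) r, ?_, ?_⟩⟩
  · have := hm ⟨g, rfl⟩
    simp only at this
    simp
    omega
  · simp [hw, hr]

/-- The distributions of a random walk on a finite group, with uniformly chosen steps that generate
the group and one of which is trivial, converge to the uniform distribution: over a fixed number
of steps the oscillation of the distribution shrinks by a constant factor. -/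
theorem tendsto_walk [Fintype G] (hp : ∀ l g, p (l + 1) g = (∑ r, p l ((σ r)⁻¹ * g)) / M)
    (h1 : ∃ r, σ r = 1) (hgen : Subgroup.closure (range σ) = ⊤) (hsum : ∑ g, p 0 g = 1) (g : G) :
    Tendsto (fun l => p l g) atTop (𝓝 (1 / Fintype.card G)) := by
  have hM : 0 < M := h1.choose.pos
  have hM' : (0 : ℝ) < M := by exact_mod_cast hM
  have hsum' : ∀ l, ∑ g, p l g = 1 := by
    intro l
    induction l with
    | zero => exact hsum
    | succ l ih =>
      simp_rw [hp]
      rw [← Finset.sum_div, Finset.sum_comm]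
      have : ∀ r, ∑ g, p l ((σ r)⁻¹ * g) = 1 := fun r =>
        (Equiv.sum_comp (Equiv.mulLeft (σ r)⁻¹) (p l)).trans ih
      simp [this, hM'.ne']
  obtain ⟨m, hm⟩ := exists_uniform_word_length h1 hgen
  -- the deficit at a minimum of the distribution reaches every element within `m` steps
  set ε : ℝ := 1 / (M : ℝ) ^ m
  have hε0 : 0 < ε := by positivity
  have hε1 : ε ≤ 1 := by
    rw [div_le_one (by positivity)]
    exact one_le_pow₀ (by exact_mod_cast hM)
  obtain ⟨gmax, hgmax⟩ := Finite.exists_max (p 0)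
  obtain ⟨gmin, hgmin⟩ := Finite.exists_min (p 0)
  set δ := p 0 gmax - p 0 gmin
  have hosc : ∀ n : ℕ, ∃ B b, (∀ g, b ≤ p (n * m) g ∧ p (n * m) g ≤ B) ∧
      B - b ≤ (1 - ε) ^ n * δ := by
    intro n
    induction n with
    | zero => exact ⟨p 0 gmax, p 0 gmin, by simpa using fun g => ⟨hgmin g, hgmax g⟩, by simp [δ]⟩
    | succ n ih =>
      obtain ⟨B, b, hBb, hle⟩ := ih
      obtain ⟨g0, hg0⟩ := Finite.exists_min (p (n * m))
      refine ⟨B - (B - p (n * m) g0) * ε, p (n * m) g0, fun g => ⟨?_, ?_⟩, ?_⟩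
      · rw [add_mul, one_mul]
        exact ge_of_walk hp hM hg0 m g
      · obtain ⟨w, hwl, hwg⟩ := hm (g * g0⁻¹)
        have := walk_word_le hp hM (fun g => (hBb g).2) w g0
        rw [hwl, hwg, inv_mul_cancel_right, div_eq_mul_one_div] at this
        rwa [add_mul, one_mul]
      · have h2 : B - p (n * m) g0 ≤ (1 - ε) ^ n * δ := by linarith [(hBb g0).1]
        have h3 := mul_le_mul_of_nonneg_left h2 (sub_nonneg.2 hε1)
        rw [pow_succ]
        linarith
  have hcard : (0 : ℝ) < Fintype.card G := by exact_mod_cast Fintype.card_pos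
  rw [Metric.tendsto_atTop]
  intro η hη
  have hlim : Tendsto (fun n => (1 - ε) ^ n * δ) atTop (𝓝 (0 * δ)) :=
    (tendsto_pow_atTop_nhds_zero_of_lt_one (by linarith) (by linarith)).mul_const _
  rw [zero_mul] at hlim
  obtain ⟨n, hn⟩ := (hlim.eventually_lt_const hη).exists
  refine ⟨n * m, fun l hl => ?_⟩
  obtain ⟨k, rfl⟩ := Nat.exists_eq_add_of_le hl
  obtain ⟨B, b, hBb, hle⟩ := hosc n
  have hup := le_of_walk hp hM (fun g => (hBb g).2) k
  have hlo := ge_of_walk hp hM (fun g => (hBb g).1) k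
  -- the average value `1 / |G|` lies between the same bounds
  have h2 : 1 / (Fintype.card G : ℝ) ≤ B := by
    rw [div_le_iff₀ hcard, ← hsum' (n * m + k)]
    refine (Finset.sum_le_sum fun g _ => hup g).trans (le_of_eq ?_)
    simp [mul_comm]
  have h3 : b ≤ 1 / (Fintype.card G : ℝ) := by
    rw [le_div_iff₀ hcard, ← hsum' (n * m + k)]
    refine le_trans (le_of_eq ?_) (Finset.sum_le_sum fun g _ => hlo g)
    simp [mul_comm]
  have h4 := hup g
  have h5 := hlo g
  rw [Real.dist_eq, abs_lt]
  constructor <;> linarith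

end Walk

/-! ### Neutral orientation of the Meurthe curves -/

theorem card_orientation_succ {d : ℕ} (S : RegularRuleSystem 3 d) (l : ℕ) (π : Equiv.Perm (Fin d)) :
    Nat.card {R : Fin (l + 1) → Fin (3 ^ d) // S.orientation (l + 1) R = π} =
      ∑ r, Nat.card {R : Fin l → Fin (3 ^ d) //
        S.orientation l R = (S.rotation S.start r)⁻¹ * π} := by
  classical
  simp only [Nat.card_eq_fintype_card, Fintype.card_subtype, Finset.card_filter]
  rw [← (Fin.snocEquiv fun _ => Fin (3 ^ d)).sum_comp, Fintype.sum_prod_type]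
  refine Finset.sum_congr rfl fun r _ => Finset.sum_congr rfl fun R _ => ?_
  simp [RegularRuleSystem.orientation, Fin.snocEquiv, eq_inv_mul_iff_mul_eq]

/-- If the rotations of a mono-curve generate all permutations and one of them is trivial, then
the mono-curve has neutral orientation. -/
theorem hasNeutralOrientation_of_closure {d : ℕ} (S : RegularRuleSystem 3 d) (hS : S.IsMono)
    (h1 : ∃ r, S.rotation S.start r = 1)
    (hgen : Subgroup.closure (range (S.rotation S.start)) = ⊤) : S.HasNeutralOrientation := by
  refine ⟨hS, fun π => ?_⟩
  have h := tendsto_walk (σ := S.rotation S.start) (p := fun l π =>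
    (Nat.card {R : Fin l → Fin (3 ^ d) // S.orientation l R = π} : ℝ) / ((3 : ℝ) ^ d) ^ l)
    (fun l π => ?_) h1 hgen ?_ π
  · rw [Fintype.card_perm, Fintype.card_fin] at h
    exact_mod_cast h
  · simp only [card_orientation_succ]
    push_cast
    rw [← Finset.sum_div, div_div, pow_succ]
  · classical
    simp [RegularRuleSystem.orientation, Nat.card_eq_fintype_card, Fintype.card_subtype,
      Finset.filter_const, apply_ite Finset.card]

theorem exists_digit_eq (d : ℕ) (x : Fin d → Fin 3) :
    ∃ r : Fin (3 ^ d), ∀ i, digit 3 r i = x i := by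
  induction d with
  | zero => exact ⟨0, fun i => i.elim0⟩
  | succ d ih =>
    obtain ⟨q, hq⟩ := ih fun i => x i.succ
    refine ⟨consRank (x 0) q, fun i => ?_⟩
    refine Fin.cases (digit_consRank_zero _ _) (fun i => ?_) i
    rw [digit_consRank_succ, hq]

/-- If all digits are twos, except for a zero at position `i`, then the rotation of the Meurthe
curve is the cycle `0 ↦ 1 ↦ ⋯ ↦ i ↦ 0`. -/
theorem exists_meurthe_rotation_eq_cycleRange {d : ℕ} (i : Fin d) :
    ∃ r, (meurthe d).rotation (meurthe d).start r = i.cycleRange := by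
  obtain ⟨r, hr⟩ := exists_digit_eq d fun j => if j = i then 0 else 2
  refine ⟨r, Equiv.ext fun j => Fin.ext ?_⟩
  change meurtheIndex r j = _
  have hd : NeZero d := ⟨i.pos.ne'⟩
  rw [meurtheIndex, hr]
  rcases lt_trichotomy j i with hij | rfl | hij
  · have hset : (Finset.univ.filter fun l => j < l ∧ digit 3 r l = 2) =
        (Finset.Ioi j).erase i := by
      ext l
      by_cases hl : l = i <;> simp [hr, hl]
    rw [hset, Finset.card_erase_of_mem (Finset.mem_Ioi.2 hij), Fin.card_Ioi,
      Fin.coe_cycleRange_of_lt hij]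
    have := i.2
    have hij' : (j : ℕ) < i := hij
    simp [hij.ne]
    omega
  · have hset : (Finset.univ.filter fun l => j < l ∧ (digit 3 r l = 0 ∨ digit 3 r l = 1)) = ∅ := by
      ext l
      by_cases hl : l = j <;> simp [hr, hl]
    rw [hset, Fin.cycleRange_self]
    simp
  · have hset : (Finset.univ.filter fun l => j < l ∧ digit 3 r l = 2) = Finset.Ioi j := by
      ext l
      by_cases hl : l = i
      · simp [hr, hl, hij.le]
      · simp [hr, hl]
    rw [hset, Fin.card_Ioi, Fin.cycleRange_of_gt hij]
    have := j.2
    simp [hij.ne']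
    omega

theorem cycleRange_one {n : ℕ} : (1 : Fin (n + 2)).cycleRange = Equiv.swap 0 1 := by
  ext j : 1
  rw [Fin.cycleRange_apply]
  rcases Fin.lt_or_eq_of_le (Fin.zero_le j) with h0 | rfl
  · rcases (Fin.one_le_of_ne_zero h0.ne').lt_or_eq with h1 | h1
    · rw [if_neg h1.not_gt, if_neg h1.ne', Equiv.swap_apply_of_ne_of_ne h0.ne' h1.ne']
    · simp [← h1]
  · simp

theorem meurthe_hasNeutralOrientation {d : ℕ} (hd : 1 ≤ d) :
    (meurthe d).HasNeutralOrientation := by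
  have hmem : ∀ i : Fin d, i.cycleRange ∈
      Subgroup.closure (range ((meurthe d).rotation (meurthe d).start)) := fun i =>
    Subgroup.subset_closure (exists_meurthe_rotation_eq_cycleRange i)
  obtain ⟨n, rfl⟩ := Nat.exists_eq_add_of_le' hd
  refine hasNeutralOrientation_of_closure _ (inferInstanceAs (Subsingleton Unit)) ?_ ?_
  -- the identity is the cycle for `i = 0`
  · obtain ⟨r, hr⟩ := exists_meurthe_rotation_eq_cycleRange (0 : Fin (n + 1))
    exact ⟨r, hr.trans (Fin.cycleRange_zero _)⟩
  · cases n with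
    | zero =>
      rw [eq_top_iff]
      intro x _
      have hx : x = 1 := Equiv.ext fun j => Subsingleton.elim (α := Fin 1) _ _
      rw [hx]
      exact one_mem _
    | succ n =>
      -- the full cycle and the transposition of two axes adjacent in it generate
      rw [eq_top_iff, ← Equiv.Perm.closure_cycle_adjacent_swap (isCycle_finRotate (n := n))
        support_finRotate 0, Subgroup.closure_le]
      rintro _ (rfl | rfl)
      · rw [← Fin.cycleRange_last]
        exact hmem _
      · have : finRotate (n + 2) 0 = 1 := by simp
        rw [this, ← cycleRange_one]
        exact hmem _

end SpaceFilling

theorem mainTheorem2 :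
    (∀ S ∈ ({peano, coil, halfCoil, meurthe} : Set ((d : ℕ) → RegularRuleSystem 3 d)),
      (∀ d : ℕ, 1 ≤ d →
        (S d).Describes (S d).curve ∧ (S d).IsMono ∧ (S d).IsOrderPreserving ∧
          (S d).IsVertexContinuous) ∧
      IsInterdimensionallyConsistent (fun d => (S d).curve) ∧
      (∀ d : ℕ, 1 ≤ d → ∀ (i : Fin (d + 1)) (e : unitInterval), e = 0 ∨ e = 1 →
        ShowsOnFace (S (d + 1)).curve (S d).curve i e)) ∧
    (∀ d : ℕ, 1 ≤ d → (meurthe d).HasNeutralOrientation) := by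
  refine ⟨fun S hS => ?_, fun d hd => meurthe_hasNeutralOrientation hd⟩
  obtain ⟨A, hA, rfl⟩ : ∃ A, IsFaceCompatible A ∧ S = fun d => wunderlich d (A d) := by
    rcases hS with rfl | rfl | rfl | rfl
    · exact ⟨_, isFaceCompatible_one, rfl⟩
    · exact ⟨_, isFaceCompatible_rev, rfl⟩
    · exact ⟨_, isFaceCompatible_parity, rfl⟩
    · exact ⟨_, isFaceCompatible_meurthe, rfl⟩
  have hmono : ∀ d, (wunderlich d (A d)).IsMono := fun d => inferInstanceAs (Subsingleton Unit)
  refine ⟨fun d hd => ⟨describes_curve _ hd, hmono d, ⟨hmono d, fun _ _ => rfl⟩,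
    isVertexContinuous _⟩, isInterdimensionallyConsistent hA, fun d hd i e he => ?_⟩
  rcases he with rfl | rfl
  · exact showsOnFace hA hd i false
  · exact showsOnFace hA hd i true
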